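/- **Theorem 2 (Poincaré–Birkhoff–Witt theorem for $U'_q(\mathrm{so}_n)$).** Let $n$ be a natural number, let $q\in\mathbb C\setminus\{0\}$ and fix a square root $q^{1/2}$ of $q$; put $q^{-1/2}=(q^{1/2})^{-1}$. If $n\ge 4$, assume $q^2\neq -1$. Let $U'_q(\mathrm{so}_n)$ be the complex associative unital algebra generated by elements $I_{21},I_{32},\dots,I_{n,n-1}$ subject to the relations $$I_{i,i-1}^2I_{i+1,i}-(q+q^{-1})I_{i,i-1}I_{i+1,i}I_{i,i-1}+I_{i+1,i}I_{i,i-1}^2=-I_{i+1,i},$$ $$I_{i,i-1}I_{i+1,i}^2-(q+q^{-1})I_{i+1,i}I_{i,i-1}I_{i+1,i}+I_{i+1,i}^2I_{i,i-1}=-I_{i,i-1},$$ $$I_{i,i-1}I_{j,j-1}-I_{j,j-1}I_{i,i-1}=0\quad\text{for } |i-j|>1 .$$ Put $I^{\pm}_{k,k-1}=I_{k,k-1}$ and define recursively, for $1\le l$, $l+1<k\le n$, $$I^{\pm}_{kl}=q^{\pm1/2}I_{l+1,l}I^{\pm}_{k,l+1}-q^{\mp1/2}I^{\pm}_{k,l+1}I_{l+1,l}.$$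 Then the ordered monomials $$(I^+_{21})^{m_{21}}(I^+_{31})^{m_{31}}\cdots(I^+_{n1})^{m_{n1}}(I^+_{32})^{m_{32}}(I^+_{42})^{m_{42}}\cdots(I^+_{n2})^{m_{n2}}\cdots(I^+_{n,n-1})^{m_{n,n-1}},\qquad m_{ij}=0,1,2,\dots,$$ form a basis of the vector space $U'_q(\mathrm{so}_n)$ (distinct families of exponents giving distinct basis elements). The same holds with every $I^+_{ij}$ replaced by $I^-_{ij}$. -/

import Mathlib

namespace QSo

/-- Labels of the generators `I_{k,k-1}`, `k = 2, …, n`. The label `k` stands for `I_{k,k-1}`. -/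
abbrev Gen (n : ℕ) : Type := {k : ℕ // 2 ≤ k ∧ k ≤ n}

/-- The generator `I_{k,k-1}` of the free algebra. -/
noncomputable abbrev freeGen {n : ℕ} (k : Gen n) : FreeAlgebra ℂ (Gen n) :=
  FreeAlgebra.ι ℂ k

/-- The defining relations of `U'_q(so_n)`. -/
inductive Rel (n : ℕ) (q : ℂ) : FreeAlgebra ℂ (Gen n) → FreeAlgebra ℂ (Gen n) → Prop
  | serre_left (i j : Gen n) (h : j.1 = i.1 + 1) : Rel n q
      (freeGen i ^ 2 * freeGen j - (q + q⁻¹) • (freeGen i * freeGen j * freeGen i)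
        + freeGen j * freeGen i ^ 2)
      (-freeGen j)
  | serre_right (i j : Gen n) (h : j.1 = i.1 + 1) : Rel n q
      (freeGen i * freeGen j ^ 2 - (q + q⁻¹) • (freeGen j * freeGen i * freeGen j)
        + freeGen j ^ 2 * freeGen i)
      (-freeGen i)
  | comm (i j : Gen n) (h : i.1 + 1 < j.1 ∨ j.1 + 1 < i.1) : Rel n q
      (freeGen i * freeGen j - freeGen j * freeGen i) 0

/-- The complex associative unital algebra `U'_q(so_n)`. -/
abbrev UqSo (n : ℕ) (q : ℂ) : Type := RingQuot (Rel n q)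

/-- The element `I_{k,k-1}` of `U'_q(so_n)` (zero when `k` is not in `{2, …, n}`; such `k` are
never used below). -/
noncomputable def gen (n : ℕ) (q : ℂ) (k : ℕ) : UqSo n q :=
  if h : 2 ≤ k ∧ k ≤ n then RingQuot.mkAlgHom ℂ (Rel n q) (freeGen ⟨k, h⟩) else 0

/-- The `q`-commutator `t x y - t⁻¹ y x`, where `t` is the square root of the deformation
parameter: it is `[x, y]_q` for `t = q^{1/2}` and `[x, y]_{q⁻¹}` for `t = q^{-1/2}`. -/
noncomputable def qComm {A : Type*} [Ring A] [Algebra ℂ A] (t : ℂ) (x y : A) : A :=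
  t • (x * y) - t⁻¹ • (y * x)

/-- The elements `I_{kl}`, `k > l`: `I_{k,k-1}` is the generator and, for `k > l + 1`,
`I_{kl} = t I_{l+1,l} I_{k,l+1} - t⁻¹ I_{k,l+1} I_{l+1,l}`. For `t = q^{1/2}` they are the
`I⁺_{kl}`, for `t = q^{-1/2}` the `I⁻_{kl}`. -/
noncomputable def rootElem (n : ℕ) (q t : ℂ) (k l : ℕ) : UqSo n q :=
  if l + 1 < k then qComm t (gen n q (l + 1)) (rootElem n q t k (l + 1)) else gen n q k
termination_by k - l

/-- The pairs `(k, l)` with `1 ≤ l < k ≤ n`. -/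
abbrev Pair (n : ℕ) : Type := {p : ℕ × ℕ // 1 ≤ p.2 ∧ p.2 < p.1 ∧ p.1 ≤ n}

/-- The exponent `m_{kl}`, extended by zero to all pairs of natural numbers. -/
def expo {n : ℕ} (m : Pair n → ℕ) (k l : ℕ) : ℕ :=
  if h : 1 ≤ l ∧ l < k ∧ k ≤ n then m ⟨(k, l), h⟩ else 0

/-- The ordered monomial
`I_{21}^{m_{21}} I_{31}^{m_{31}} ⋯ I_{n1}^{m_{n1}} I_{32}^{m_{32}} ⋯ I_{n2}^{m_{n2}} ⋯
I_{n,n-1}^{m_{n,n-1}}`: the outer product runs over `l = 1, …, n`, the inner one over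
`k = l + 1, …, n`, both in increasing order. -/
noncomputable def monomial (n : ℕ) (q t : ℂ) (m : Pair n → ℕ) : UqSo n q :=
  ((List.range' 1 n).map fun l =>
    ((List.range' (l + 1) (n - l)).map fun k => rootElem n q t k l ^ expo m k l).prod).prod

end QSo

/-!
The spanning statement and the linear independence are proved separately, and both are proved over
an arbitrary commutative ring with an invertible element `t = q^{1/2}`, for a family of elements
satisfying the defining relations with `c` in place of `q + q⁻¹`.

**Spanning.** A generator `z = I_{k+1,k}` commutes with every `I_{jl}`, `j ≠ k, k + 1`, `l < k`. For
`j > k + 1` this requires `c` to be invertible (`commute_bracket_bracket`), the only such step, and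
it needs four indices. Moreover `x = I_{kl}` and `z` satisfy both cubic relations, with bracket
`I_{k+1,l}`. Hence moving `z` to the right through the column `I_{l+1,l}, …, I_{nl}` takes place
inside a two-generator algebra, where `z xⁱ yʲ` is a combination of ordered monomials `xⁱ yʲ zᵉ`
(`span_singleton_mul_powSpan_mul_powSpan_le`). Since the first element of the column is itself a
generator, a descending induction on `l` shows that the span of the ordered monomials is a left ideal
containing `1` (`span_orderedMonomial`).

**Independence.** Tensoring with the `n`-dimensional vector representation turns a family satisfying
the relations into another one (`IsSoFamily.coact`), so that the matrix coefficients of the tensor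
powers of the vector representation are linear functionals on the universal algebra (`coeffFun`). At
`q = 1` the `I_{kl}` act on tensor products as primitive elements. Therefore the coefficients
belonging to a word `p` of length `d` vanish on all products of fewer than `d` of the `I_{kl}`, and on
a product of `d` of them they count the ways to match the product with `p` (`coeffFun_wordProd`).
In characteristic zero they separate the ordered monomials.

To reach the other values of `q`, in particular roots of unity, where these functionals need not
separate the monomials, consider the universal algebra over a localization `R` of `ℂ[X]` which has
specializations both at `X = q^{1/2}` and at `X = 1`. A linear relation over `R` has coefficients
vanishing at `X = 1`; as the functionals take values in a domain, it can be divided by `X - 1`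
indefinitely, so it is trivial (`linearIndependent_orderedMonomial_univGen`). By spanning, the
universal algebra over `R` is free on the ordered monomials, and so is its base change to `ℂ` along
`X ↦ q^{1/2}`, to which `U'_q(so_n)` maps (`linearIndependent_monomial`).
-/

namespace QSo

/-! ### Deformed brackets and the cubic relation -/

section Bracket

variable {R : Type*} [CommRing R] {A : Type*} [Ring A] [Algebra R A]

/-- The deformed bracket `t x y - t' y x`. Below `t'` is always the inverse of `t`, a
separate variable because `t` lives in an arbitrary commutative ring. -/
def bracket (t t' : R) (x y : A) : A := t • (x * y) - t' • (y * x)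

/-- The defining cubic relation `a² b - c a b a + b a² = -b`, in which `c` plays the role of
`q + q⁻¹`. -/
def CubicRel (c : R) (a b : A) : Prop :=
  a ^ 2 * b - c • (a * b * a) + b * a ^ 2 = -b

variable {t t' c : R}

theorem commute_bracket {x y z : A} (h : Commute z x) (h' : Commute z y) :
    Commute z (bracket t t' x y) :=
  ((h.mul_right h').smul_right t).sub_right ((h'.mul_right h).smul_right t')

/-- The deformed bracket is associative on `a`, `b`, `z` when the outer arguments commute. -/
theorem bracket_assoc {a b z : A} (h : Commute a z) :
    bracket t t' a (bracket t t' b z) = bracket t t' (bracket t t' a b) z := by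
  have h1 : a * z = z * a := h
  have h2 : b * (a * z) = b * (z * a) := by rw [h1]
  have h3 : a * (z * b) = z * (a * b) := by rw [← mul_assoc, h1, mul_assoc]
  simp only [bracket, mul_sub, sub_mul, smul_sub, mul_smul_comm, smul_mul_assoc, mul_assoc, h2, h3]
  module

/-- The cubic relation says that bracketing with `a` twice, once on each side, gives back `b`. -/
theorem cubicRel_iff_left (h : t * t' = 1) (hc : c = t ^ 2 + t' ^ 2) {a b : A} :
    CubicRel c a b ↔ bracket t t' (bracket t t' a b) a = b := by
  have key : bracket t t' (bracket t t' a b) a - b =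
      -(a ^ 2 * b - c • (a * b * a) + b * a ^ 2 - -b) := by
    subst hc
    simp only [bracket, mul_sub, sub_mul, smul_sub, mul_smul_comm, smul_mul_assoc, mul_assoc,
      pow_two]
    match_scalars <;> grind
  rw [CubicRel, ← sub_eq_zero, ← neg_eq_zero, ← key, sub_eq_zero]

theorem cubicRel_iff_right (h : t * t' = 1) (hc : c = t ^ 2 + t' ^ 2) {a b : A} :
    CubicRel c a b ↔ bracket t t' a (bracket t t' b a) = b := by
  have key : bracket t t' a (bracket t t' b a) - b =
      -(a ^ 2 * b - c • (a * b * a) + b * a ^ 2 - -b) := by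
    subst hc
    simp only [bracket, mul_sub, sub_mul, smul_sub, mul_smul_comm, smul_mul_assoc, mul_assoc,
      pow_two]
    match_scalars <;> grind
  rw [CubicRel, ← sub_eq_zero, ← neg_eq_zero, ← key, sub_eq_zero]

theorem CubicRel.bracket_right {a b z : A} (hab : CubicRel c a b) (hz : Commute a z) :
    CubicRel c a (bracket t t' b z) := by
  have hab' : a ^ 2 * b - c • (a * b * a) + b * a ^ 2 = -b := hab
  have h1 : a * z = z * a := hz
  have h2 : ∀ x, a * (z * x) = z * (a * x) := fun x => by rw [← mul_assoc, h1, mul_assoc]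
  have key : a ^ 2 * bracket t t' b z - c • (a * bracket t t' b z * a) +
      bracket t t' b z * a ^ 2 =
      bracket t t' (a ^ 2 * b - c • (a * b * a) + b * a ^ 2) z := by
    simp only [bracket, mul_sub, sub_mul, smul_sub, mul_smul_comm, smul_mul_assoc, mul_assoc,
      pow_two, mul_add, add_mul, smul_add, h1, h2]
    module
  rw [CubicRel, key, hab']
  simp only [bracket, neg_mul, mul_neg, smul_neg, neg_sub]
  abel

/-- Reversing the arguments of a deformed bracket amounts to replacing `(t, t')` by `(-t', -t)`. -/
theorem CubicRel.bracket_left {a b z : A} (hab : CubicRel c a b) (hz : Commute a z) :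
    CubicRel c a (bracket t t' z b) := by
  have : bracket t t' z b = bracket (-t') (-t) b z := by simp only [bracket]; module
  rw [this]
  exact hab.bracket_right hz

/-- The three-generator consequence of the cubic relations. Multiplying the commutator by `c` makes it a
combination of the cubic relations, so that `c` has to be invertible. -/
theorem commute_bracket_bracket (h : t * t' = 1) (hc : c = t ^ 2 + t' ^ 2) (hu : IsUnit c)
    {a b y : A} (hay : Commute a y) (ha : CubicRel c b a) (hy : CubicRel c b y) :
    Commute b (bracket t t' a (bracket t t' b y)) := by
  have h1 : y * a = a * y := hay.symm.eq
  have h2 : ∀ x, y * (a * x) = a * (y * x) := fun x => by rw [← mul_assoc, h1, mul_assoc]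
  have ha' : c • (b * a * b) = b ^ 2 * a + a * b ^ 2 + a := by
    have : b ^ 2 * a - c • (b * a * b) + a * b ^ 2 = -a := ha
    linear_combination (norm := module) -this
  have hy' : c • (b * y * b) = b ^ 2 * y + y * b ^ 2 + y := by
    have : b ^ 2 * y - c • (b * y * b) + y * b ^ 2 = -y := hy
    linear_combination (norm := module) -this
  have e1 : c • (b * a * b) * y = (b ^ 2 * a + a * b ^ 2 + a) * y := by rw [ha']
  have e2 : y * c • (b * a * b) = y * (b ^ 2 * a + a * b ^ 2 + a) := by rw [ha']
  have e3 : c • (b * y * b) * a = (b ^ 2 * y + y * b ^ 2 + y) * a := by rw [hy']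
  have e4 : a * c • (b * y * b) = a * (b ^ 2 * y + y * b ^ 2 + y) := by rw [hy']
  have key : c • (b * bracket t t' a (bracket t t' b y) -
      bracket t t' a (bracket t t' b y) * b) = 0 := by
    subst hc
    simp only [bracket, mul_sub, sub_mul, smul_sub, mul_smul_comm, smul_mul_assoc, mul_assoc,
      pow_two, mul_add, add_mul, h1, h2] at e1 e2 e3 e4 ⊢
    linear_combination (norm := skip) t ^ 2 • e1 - t' ^ 2 • e2 + t' ^ 2 • e3 - t ^ 2 • e4
    match_scalars <;> grind
  have := (hu.smul_eq_zero).1 key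
  exact sub_eq_zero.1 this

/-- The cubic relation passes from `(a, b)` and `(b, z)` to `(bracket a b, z)`, provided that the
middle element `b` commutes with the triple bracket. -/
theorem CubicRel.bracket_bracket (h : t * t' = 1) (hc : c = t ^ 2 + t' ^ 2) {a b z : A}
    (haz : Commute a z) (hb : Commute b (bracket t t' (bracket t t' a b) z))
    (hab : CubicRel c a b) (hbz : CubicRel c b z) : CubicRel c (bracket t t' a b) z := by
  rw [cubicRel_iff_left h hc]
  rw [← bracket_assoc haz] at hb ⊢
  have h1 := (cubicRel_iff_left h hc).1 (hab.bracket_right (t := t) (t' := t') haz)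
  have h2 := (cubicRel_iff_left h hc).1 hbz
  rw [bracket_assoc hb.symm, h1, h2]

end Bracket

/-! ### Root elements of a family satisfying the defining relations -/

section Family

variable {R : Type*} [CommRing R] {A : Type*} [Ring A] [Algebra R A]

/-- The family `g` satisfies the defining relations of `U'_q(so_n)`, with `c` in place of `q + q⁻¹`;
the element `g k` stands for `I_{k,k-1}`, and only `g 2, …, g n` matter. -/
structure IsSoFamily (n : ℕ) (c : R) (g : ℕ → A) : Prop where
  left : ∀ i, 2 ≤ i → i + 1 ≤ n → CubicRel c (g i) (g (i + 1))
  right : ∀ i, 2 ≤ i → i + 1 ≤ n → CubicRel c (g (i + 1)) (g i)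
  comm : ∀ i j, 2 ≤ i → i + 1 < j → j ≤ n → Commute (g i) (g j)

/-- The elements `I_{kl}`, `k > l`, formed from a family `g`, by the recursion which lowers `l`. -/
def root (t t' : R) (g : ℕ → A) (k l : ℕ) : A :=
  if l + 1 < k then bracket t t' (g (l + 1)) (root t t' g k (l + 1)) else g k
termination_by k - l

variable {t t' c : R} {g : ℕ → A} {n : ℕ}

theorem root_of_lt {k l : ℕ} (h : l + 1 < k) :
    root t t' g k l = bracket t t' (g (l + 1)) (root t t' g k (l + 1)) := by
  rw [root, if_pos h]

theorem root_of_not_lt {k l : ℕ} (h : ¬ l + 1 < k) : root t t' g k l = g k := by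
  rw [root, if_neg h]

theorem root_succ_self (l : ℕ) : root t t' g (l + 1) l = g (l + 1) :=
  root_of_not_lt (lt_irrefl _)

/-- Induction on the length `k - l` of a root, with `k` fixed. -/
theorem root_induction {k : ℕ} {P : ℕ → Prop} (base : ∀ l, k = l + 1 → P l)
    (step : ∀ l, l + 1 < k → P (l + 1) → P l) (l : ℕ) (h : l < k) : P l := by
  obtain ⟨d, rfl⟩ := Nat.exists_eq_add_of_lt h
  clear h
  induction d generalizing l with
  | zero => exact base l rfl
  | succ d ih =>
    have e : l + (d + 1) + 1 = l + 1 + d + 1 := by omega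
    rw [e] at base step
    exact step l (by omega) (ih (l + 1) base step)

/-- An element commuting with all generators occurring in `I_{kl}` commutes with `I_{kl}`. -/
theorem commute_root {z : A} {k l : ℕ} (hl : l < k)
    (h : ∀ i, l < i → i ≤ k → Commute z (g i)) : Commute z (root t t' g k l) := by
  revert h
  refine root_induction (P := fun l => (∀ i, l < i → i ≤ k → Commute z (g i)) →
    Commute z (root t t' g k l)) (fun l hk h => ?_) (fun l hlk ih h => ?_) l hl
  · rw [root_of_not_lt (by omega)]
    exact h k (by omega) le_rfl
  · rw [root_of_lt hlk]
    exact commute_bracket (h _ (by omega) (by omega)) (ih fun i hi hik => h i (by omega) hik)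

/-- The elements `I_{kl}` also satisfy the recursion which raises `k`. -/
theorem root_succ (hg : IsSoFamily n c g) {k l : ℕ} (hl : 1 ≤ l) (hlk : l < k) (hkn : k + 1 ≤ n) :
    root t t' g (k + 1) l = bracket t t' (root t t' g k l) (g (k + 1)) := by
  revert hl
  refine root_induction (P := fun l => 1 ≤ l → root t t' g (k + 1) l =
    bracket t t' (root t t' g k l) (g (k + 1))) (fun l hk hl => ?_) (fun l hlk ih hl => ?_) l hlk
  · subst hk
    rw [root_of_lt (by omega), root_succ_self, root_succ_self]
  · rw [root_of_lt (by omega), ih (by omega), root_of_lt hlk,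
      bracket_assoc (hg.comm _ _ (by omega) (by omega) hkn)]

namespace IsSoFamily

variable (t t')

theorem commute_root_of_lt (hg : IsSoFamily n c g) {j k l : ℕ} (hl : 1 ≤ l) (hlk : l < k)
    (hkj : k + 1 < j) (hj : j ≤ n) : Commute (g j) (root t t' g k l) :=
  commute_root hlk fun i hi hik => (hg.comm i j (by omega) (by omega) hj).symm

theorem commute_root_of_gt (hg : IsSoFamily n c g) {j k l : ℕ} (hj : 2 ≤ j) (hjl : j < l)
    (hlk : l < k) (hk : k ≤ n) : Commute (g j) (root t t' g k l) :=
  commute_root hlk fun i hi hik => hg.comm j i hj (by omega) (by omega)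

variable {t t'}

theorem cubicRel_gen_root (hg : IsSoFamily n c g) {k l : ℕ} (hl : 1 ≤ l) (hlk : l < k)
    (hk : k + 1 ≤ n) : CubicRel c (g (k + 1)) (root t t' g k l) := by
  obtain rfl | h := Nat.eq_or_lt_of_le (Nat.succ_le_of_lt hlk)
  · rw [root_succ_self]
    exact hg.right _ (by omega) hk
  · obtain ⟨k, rfl⟩ : ∃ k', k = k' + 1 := ⟨k - 1, by omega⟩
    rw [root_succ hg hl (by omega) (by omega)]
    exact (hg.right _ (by omega) hk).bracket_left
      (hg.commute_root_of_lt t t' hl (by omega) (by omega) hk)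

/-- The generator `I_{k+1,k}` commutes with `I_{jl}` if `l < k` and `k + 1 < j`. -/
theorem commute_gen_root (h : t * t' = 1) (hc : c = t ^ 2 + t' ^ 2) (hu : 4 ≤ n → IsUnit c)
    (hg : IsSoFamily n c g) {j k l : ℕ} (hl : 1 ≤ l) (hlk : l < k) (hkj : k + 1 < j)
    (hj : j ≤ n) : Commute (g (k + 1)) (root t t' g j l) := by
  revert hl
  refine root_induction (P := fun l => 1 ≤ l → Commute (g (k + 1)) (root t t' g j l))
    (k := k) (fun l hk hl => ?_) (fun l hlk ih hl => ?_) l hlk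
  · subst hk
    rw [root_of_lt (by omega), root_of_lt (l := l + 1) (by omega)]
    refine commute_bracket_bracket h hc (hu (by omega))
      (hg.commute_root_of_gt t t' (by omega) (by omega) (by omega) hj)
      (hg.right _ (by omega) (by omega)) ?_
    obtain rfl | h := Nat.eq_or_lt_of_le (Nat.succ_le_of_lt hkj)
    · rw [root_of_not_lt (by omega)]
      exact hg.left _ (by omega) hj
    · rw [root_of_lt (by omega)]
      exact (hg.left _ (by omega) (by omega)).bracket_right
        (hg.commute_root_of_gt t t' (by omega) (by omega) (by omega) hj)
  · rw [root_of_lt (by omega)]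
    exact commute_bracket (hg.comm _ _ (by omega) (by omega) (by omega)).symm (ih (by omega))

/-- Induction on `k`; the step needs that `I_{k+1,k}` commutes with `I_{k+2,l}`. -/
theorem cubicRel_root_gen (h : t * t' = 1) (hc : c = t ^ 2 + t' ^ 2) (hu : 4 ≤ n → IsUnit c)
    (hg : IsSoFamily n c g) {k l : ℕ} (hl : 1 ≤ l) (hlk : l < k)
    (hk : k + 1 ≤ n) : CubicRel c (root t t' g k l) (g (k + 1)) := by
  induction k, hlk using Nat.le_induction with
  | base =>
    rw [Nat.succ_eq_add_one, root_succ_self]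
    exact hg.left _ (by omega) hk
  | succ k hlk ih =>
    have hcomm := hg.commute_gen_root h hc hu hl hlk (j := k + 2) (by omega) hk
    rw [root_succ hg hl (by omega) hk, root_succ hg hl hlk (by omega)] at hcomm
    rw [root_succ hg hl hlk (by omega)]
    exact CubicRel.bracket_bracket h hc (hg.commute_root_of_lt t t' hl hlk (by omega) hk).symm
      hcomm (ih (by omega)) (hg.left _ (by omega) hk)

end IsSoFamily
end Family

/-! ### Spanning by ordered monomials -/

section Spanning

variable {R : Type*} [CommRing R] {A : Type*} [Ring A] [Algebra R A]

variable (R) in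
/-- The linear span of the powers of an element. -/
def powSpan (a : A) : Submodule R A := Submodule.span R (Set.range fun m : ℕ => a ^ m)

theorem pow_mem_powSpan (a : A) (m : ℕ) : a ^ m ∈ powSpan R a :=
  Submodule.subset_span ⟨m, rfl⟩

theorem one_le_powSpan (a : A) : 1 ≤ powSpan R a := by
  rw [Submodule.one_le]
  simpa using pow_mem_powSpan (R := R) a 0

theorem span_singleton_mul_powSpan_le (a : A) : (R ∙ a) * powSpan R a ≤ powSpan R a := by
  rw [powSpan, Submodule.span_mul_span, Submodule.span_le]
  rintro _ ⟨_, rfl, _, ⟨m, rfl⟩, rfl⟩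
  exact Submodule.subset_span ⟨m + 1, pow_succ' _ _⟩

theorem powSpan_mul_le {a : A} {S : Submodule R A} (h : (R ∙ a) * S ≤ S) : powSpan R a * S ≤ S := by
  rw [Submodule.mul_le]
  intro x hx s hs
  induction hx using Submodule.span_induction with
  | mem x hx =>
    obtain ⟨m, rfl⟩ := hx
    induction m with
    | zero => simpa using hs
    | succ m ih =>
      simp only [pow_succ', mul_assoc]
      exact h (Submodule.mul_mem_mul (Submodule.mem_span_singleton_self a) ih)
  | zero => simp
  | add x y _ _ hx hy => rw [add_mul]; exact add_mem hx hy
  | smul r x _ hx => rw [smul_mul_assoc]; exact Submodule.smul_mem _ _ hx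

theorem commute_span {S T : Set A} (h : ∀ a ∈ S, ∀ b ∈ T, Commute a b) :
    Commute (Submodule.span R S) (Submodule.span R T) := by
  rw [Commute, SemiconjBy, Submodule.span_mul_span, Submodule.span_mul_span]
  congr 1
  ext x
  constructor
  · rintro ⟨a, ha, b, hb, rfl⟩
    exact ⟨b, hb, a, ha, (h a ha b hb).symm.eq⟩
  · rintro ⟨b, hb, a, ha, rfl⟩
    exact ⟨a, ha, b, hb, (h a ha b hb).eq⟩

theorem commute_span_singleton_powSpan {a b : A} (h : Commute a b) :
    Commute (R ∙ a) (powSpan R b) :=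
  commute_span <| by
    rintro _ rfl _ ⟨m, rfl⟩
    exact h.pow_right m

theorem commute_powSpan {a b : A} (h : Commute a b) : Commute (powSpan R a) (powSpan R b) :=
  commute_span <| by
    rintro _ ⟨m, rfl⟩ _ ⟨k, rfl⟩
    exact h.pow_pow m k

/-- The straightening step: in the two-generator algebra generated by `x`, `z` and their bracket `y`, a
product `z xⁱ yʲ` is a combination of ordered monomials `xⁱ yʲ zᵉ`. -/
theorem span_singleton_mul_powSpan_mul_powSpan_le {t t' c : R} (h : t * t' = 1)
    (hc : c = t ^ 2 + t' ^ 2) {x z : A} (hxz : CubicRel c x z) (hzx : CubicRel c z x) :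
    (R ∙ z) * (powSpan R x * powSpan R (bracket t t' x z)) ≤
      powSpan R x * powSpan R (bracket t t' x z) * powSpan R z := by
  set y := bracket t t' x z with hy
  -- The three commutation rules of the two-generator algebra, applied to the right factor `w`.
  have hzx' : ∀ w, z * (x * w) = (t ^ 2) • (x * (z * w)) - t • (y * w) := fun w => by
    simp only [hy, bracket, sub_mul, smul_sub, smul_mul_assoc, mul_assoc]
    match_scalars <;> grind
  have hyx : ∀ w, y * (x * w) = t' • (z * w) + t' ^ 2 • (x * (y * w)) := fun w => by
    have e := congrArg (· * w) ((cubicRel_iff_left h hc).1 hxz)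
    simp only [← hy] at e
    simp only [bracket, sub_mul, smul_mul_assoc, mul_assoc] at e
    rw [← e]
    match_scalars <;> grind
  have hzy : ∀ w, z * (y * w) = t' • (x * w) + t' ^ 2 • (y * (z * w)) := fun w => by
    have e := congrArg (· * w) ((cubicRel_iff_right h hc).1 hzx)
    simp only [← hy] at e
    simp only [bracket, sub_mul, smul_mul_assoc, mul_assoc] at e
    rw [← e]
    match_scalars <;> grind
  clear_value y
  -- The filtration by total degree, along which both `y` and `z` are moved to the right.
  let W : ℕ → Submodule R A := fun d =>
    Submodule.span R {w | ∃ i j e : ℕ, i + j + e ≤ d ∧ w = x ^ i * (y ^ j * z ^ e)}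
  have hW : ∀ {d i j e : ℕ}, i + j + e ≤ d → x ^ i * (y ^ j * z ^ e) ∈ W d :=
    fun hd => Submodule.subset_span ⟨_, _, _, hd, rfl⟩
  have mono : ∀ {d d' : ℕ}, d ≤ d' → W d ≤ W d' := fun hd => Submodule.span_mono <| by
    rintro _ ⟨i, j, e, h, rfl⟩
    exact ⟨i, j, e, h.trans hd, rfl⟩
  have lift : ∀ {a : A} {d : ℕ}, (∀ i j e, i + j + e ≤ d → a * (x ^ i * (y ^ j * z ^ e)) ∈ W (d + 1)) →
      ∀ w ∈ W d, a * w ∈ W (d + 1) := fun {a d} ha w hw => by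
    induction hw using Submodule.span_induction with
    | mem w hw =>
      obtain ⟨i, j, e, hd, rfl⟩ := hw
      exact ha i j e hd
    | zero => simp
    | add u v _ _ hu hv => rw [mul_add]; exact add_mem hu hv
    | smul r u _ hu => rw [mul_smul_comm]; exact Submodule.smul_mem _ _ hu
  have hx : ∀ {d : ℕ}, ∀ w ∈ W d, x * w ∈ W (d + 1) := lift fun i j e hd => by
    rw [← mul_assoc, ← pow_succ']
    exact hW (by omega)
  have main : ∀ d, (∀ w ∈ W d, y * w ∈ W (d + 1)) ∧ (∀ w ∈ W d, z * w ∈ W (d + 1)) := by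
    intro d
    induction d with
    | zero =>
      constructor <;> refine lift fun i j e hd => ?_ <;>
        obtain ⟨rfl, rfl, rfl⟩ : i = 0 ∧ j = 0 ∧ e = 0 := by omega
      · simpa using hW (d := 1) (i := 0) (j := 1) (e := 0) (by omega)
      · simpa using hW (d := 1) (i := 0) (j := 0) (e := 1) (by omega)
    | succ d ih =>
      -- The claim on `y` in degree `d + 1` is used in the proof of the one on `z`.
      have hy' : ∀ w ∈ W (d + 1), y * w ∈ W (d + 1 + 1) := lift fun i j e hd => by
        cases i with
        | zero =>
          rw [pow_zero, one_mul, ← mul_assoc, ← pow_succ', ← one_mul (y ^ _ * _), ← pow_zero x]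
          exact hW (by omega)
        | succ i =>
          rw [pow_succ', mul_assoc, hyx]
          have hw : x ^ i * (y ^ j * z ^ e) ∈ W d := hW (by omega)
          exact add_mem (Submodule.smul_mem _ _ (mono (by omega) (ih.2 _ hw)))
            (Submodule.smul_mem _ _ (hx _ (ih.1 _ hw)))
      refine ⟨hy', lift fun i j e hd => ?_⟩
      cases i with
      | succ i =>
        rw [pow_succ', mul_assoc, hzx']
        have hw : x ^ i * (y ^ j * z ^ e) ∈ W d := hW (by omega)
        exact sub_mem (Submodule.smul_mem _ _ (hx _ (ih.2 _ hw)))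
          (Submodule.smul_mem _ _ (mono (by omega) (ih.1 _ hw)))
      | zero =>
        cases j with
        | zero =>
          have := hW (d := d + 1 + 1) (i := 0) (j := 0) (e := e + 1) (by omega)
          simpa [pow_succ'] using this
        | succ j =>
          have hw : x ^ 0 * (y ^ j * z ^ e) ∈ W d := hW (by omega)
          rw [pow_zero, one_mul] at hw ⊢
          rw [pow_succ', mul_assoc, hzy]
          exact add_mem (Submodule.smul_mem _ _ (mono (by omega) (hx _ hw)))
            (Submodule.smul_mem _ _ (hy' _ (ih.2 _ hw)))
  have hle : ∀ d, W d ≤ powSpan R x * powSpan R y * powSpan R z := fun d => by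
    rw [Submodule.span_le]
    rintro _ ⟨i, j, e, -, rfl⟩
    rw [← mul_assoc]
    exact Submodule.mul_mem_mul (Submodule.mul_mem_mul (pow_mem_powSpan _ _)
      (pow_mem_powSpan _ _)) (pow_mem_powSpan _ _)
  rw [powSpan, powSpan, Submodule.span_mul_span, Submodule.span_mul_span, Submodule.span_le]
  rintro _ ⟨_, rfl, _, ⟨_, ⟨i, rfl⟩, _, ⟨j, rfl⟩, rfl⟩, rfl⟩
  have := (main (i + j)).2 _ (hW (i := i) (j := j) (e := 0) (by omega))
  rw [pow_zero, mul_one] at this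
  rw [← Submodule.span_mul_span]
  exact hle _ this

/-- The pairs `(k, l)` with `1 ≤ l < k ≤ n`, in the order in which the `I_{kl}` occur in the ordered
monomials. -/
def pairs (n : ℕ) : List (ℕ × ℕ) :=
  (List.range' 1 n).flatMap fun l => (List.range' (l + 1) (n - l)).map fun k => (k, l)

theorem mem_pairs {n : ℕ} {p : ℕ × ℕ} : p ∈ pairs n ↔ 1 ≤ p.2 ∧ p.2 < p.1 ∧ p.1 ≤ n := by
  obtain ⟨k, l⟩ := p
  simp only [pairs, List.mem_flatMap, List.mem_map, List.mem_range'_1, Prod.mk.injEq]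
  constructor
  · rintro ⟨l, hl, k, hk, rfl, rfl⟩
    omega
  · intro h
    exact ⟨l, by omega, k, by omega, rfl, rfl⟩

theorem nodup_pairs (n : ℕ) : (pairs n).Nodup := by
  rw [pairs, List.nodup_flatMap]
  refine ⟨fun l _ => (List.nodup_range' (h := by decide)).map fun a b h => (Prod.mk.inj h).1, ?_⟩
  refine (List.nodup_range' (h := by decide)).imp ?_
  intro a b hab p hp hp'
  simp only [List.mem_map] at hp hp'
  obtain ⟨_, _, rfl⟩ := hp
  obtain ⟨_, _, h⟩ := hp'
  exact hab (Prod.mk.inj h).2.symm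

/-- The letters have to be distinct, so that their exponents can be chosen independently. -/
theorem list_prod_powSpan_le {ι : Type*} [DecidableEq ι] (x : ι → A) (L : List ι) (hL : L.Nodup) :
    (L.map fun i => powSpan R (x i)).prod ≤
      Submodule.span R (Set.range fun e : ι → ℕ => (L.map fun i => x i ^ e i).prod) := by
  induction L with
  | nil =>
    rw [List.map_nil, List.prod_nil, Submodule.one_le]
    exact Submodule.subset_span ⟨0, rfl⟩
  | cons a L ih =>
    rw [List.nodup_cons] at hL
    rw [List.map_cons, List.prod_cons]
    refine (mul_le_mul_right (ih hL.2) _).trans ?_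
    rw [powSpan, Submodule.span_mul_span, Submodule.span_le]
    rintro _ ⟨_, ⟨m, rfl⟩, _, ⟨e, rfl⟩, rfl⟩
    refine Submodule.subset_span ⟨Function.update e a m, ?_⟩
    simp only [List.map_cons, List.prod_cons, Function.update_self]
    congr 2
    refine List.map_congr_left fun i hi => ?_
    rw [Function.update_of_ne (ne_of_mem_of_not_mem hi hL.1)]

/-- The span of the ordered products of powers of the `I_{kl}` with `l ≥ l₀`, where `k` runs up to
`n` and `l₀ + d = n + 1`. -/
def columnsSpan (R : Type*) [CommRing R] {A : Type*} [Ring A] [Algebra R A] (X : ℕ → ℕ → A)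
    (n l₀ d : ℕ) : Submodule R A :=
  ((List.range' l₀ d).map fun l =>
    ((List.range' (l + 1) (n - l)).map fun k => powSpan R (X k l)).prod).prod

variable {t t' c : R} {g : ℕ → A} {n : ℕ}

/-- The columns `l, …, n` span a subspace stable under left multiplication by the generators
`I_{j,j-1}`, `j > l`: either `j = l + 1`, and the generator is the first element of column `l`, or
it passes through column `l`, creating powers of itself which are absorbed by the later columns. -/
theorem span_singleton_mul_columnsSpan_le (h : t * t' = 1) (hc : c = t ^ 2 + t' ^ 2)
    (hu : 4 ≤ n → IsUnit c) (hg : IsSoFamily n c g) (d : ℕ) {l j : ℕ} (hl : 1 ≤ l)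
    (hd : l + d = n + 1) (hlj : l < j) (hj : j ≤ n) :
    (R ∙ g j) * columnsSpan R (root t t' g) n l d ≤ columnsSpan R (root t t' g) n l d := by
  induction d generalizing l with
  | zero => omega
  | succ d ih =>
    rw [columnsSpan, List.range'_succ, List.map_cons, List.prod_cons, ← columnsSpan]
    set S := columnsSpan R (root t t' g) n (l + 1) d
    obtain rfl | hlj' := Nat.eq_or_lt_of_le (Nat.succ_le_of_lt hlj)
    · obtain ⟨e, he⟩ : ∃ e, n - l = e + 1 := ⟨n - l - 1, by omega⟩
      rw [he, List.range'_succ, List.map_cons, List.prod_cons, root_succ_self]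
      simp only [← mul_assoc]
      gcongr
      exact span_singleton_mul_powSpan_le _
    · have hS := ih (l := l + 1) (by omega) (by omega) hlj'
      obtain ⟨k, rfl⟩ : ∃ k, j = k + 1 := ⟨j - 1, by omega⟩
      have hsplit : List.range' (l + 1) (n - l) =
          List.range' (l + 1) (k - (l + 1)) ++ k :: (k + 1) :: List.range' (k + 2) (n - (k + 1)) := by
        rw [show n - l = (k - (l + 1)) + (n - (k + 1) + 1 + 1) by omega, ← List.range'_append_1,
          List.range'_succ, List.range'_succ, show l + 1 + (k - (l + 1)) = k by omega]
      rw [hsplit, List.map_append, List.prod_append, List.map_cons, List.prod_cons, List.map_cons,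
        List.prod_cons]
      have hP : Commute (R ∙ g (k + 1)) ((List.range' (l + 1) (k - (l + 1))).map fun k =>
          powSpan R (root t t' g k l)).prod := by
        refine Commute.list_prod_right _ _ fun x hx => ?_
        obtain ⟨i, hi, rfl⟩ := List.mem_map.1 hx
        rw [List.mem_range'_1] at hi
        exact commute_span_singleton_powSpan
          (hg.commute_root_of_lt t t' hl (by omega) (by omega) hj)
      have hQ : Commute (powSpan R (g (k + 1))) ((List.range' (k + 2) (n - (k + 1))).map fun k =>
          powSpan R (root t t' g k l)).prod := by
        refine Commute.list_prod_right _ _ fun x hx => ?_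
        obtain ⟨i, hi, rfl⟩ := List.mem_map.1 hx
        rw [List.mem_range'_1] at hi
        exact commute_powSpan
          (hg.commute_gen_root h hc hu hl (by omega) (by omega) (by omega))
      have hmid := span_singleton_mul_powSpan_mul_powSpan_le h hc
        (hg.cubicRel_root_gen (t := t) (t' := t') h hc hu hl (by omega) hj)
        (hg.cubicRel_gen_root hl (by omega) hj)
      rw [← root_succ hg hl (by omega) hj] at hmid
      set P := ((List.range' (l + 1) (k - (l + 1))).map fun k => powSpan R (root t t' g k l)).prod
      set Q := ((List.range' (k + 2) (n - (k + 1))).map fun k => powSpan R (root t t' g k l)).prod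
      set J := R ∙ g (k + 1)
      set U := powSpan R (root t t' g k l)
      set V := powSpan R (root t t' g (k + 1) l)
      calc J * (P * (U * (V * Q)) * S) = P * (J * (U * V)) * Q * S := by
            simp only [← mul_assoc]; rw [hP.eq]
        _ ≤ P * (U * V * powSpan R (g (k + 1))) * Q * S := by gcongr
        _ = P * (U * (V * Q)) * (powSpan R (g (k + 1)) * S) := by
            simp only [mul_assoc]; rw [← mul_assoc _ Q, hQ.eq, mul_assoc]
        _ ≤ P * (U * (V * Q)) * S := by gcongr; exact powSpan_mul_le hS

/-- The ordered monomial with exponents `m` in a doubly indexed family `X`. -/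
def orderedMonomial (X : ℕ → ℕ → A) (n : ℕ) (m : Pair n → ℕ) : A :=
  ((pairs n).map fun p => X p.1 p.2 ^ expo m p.1 p.2).prod

theorem expo_pair (e : ℕ × ℕ → ℕ) {p : ℕ × ℕ} (hp : p ∈ pairs n) :
    expo (fun i : Pair n => e i.1) p.1 p.2 = e p := by
  rw [expo, dif_pos (mem_pairs.1 hp)]

theorem one_le_list_prod (L : List (Submodule R A)) (h : ∀ S ∈ L, 1 ≤ S) : 1 ≤ L.prod := by
  induction L with
  | nil => rw [List.prod_nil]
  | cons S L ih =>
    rw [List.prod_cons, ← one_mul (1 : Submodule R A)]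
    exact mul_le_mul' (h S (by simp)) (ih fun T hT => h T (by simp [hT]))

/-- If the family generates the algebra, then the ordered monomials span it. -/
theorem span_orderedMonomial (h : t * t' = 1) (hc : c = t ^ 2 + t' ^ 2)
    (hu : 4 ≤ n → IsUnit c) (hg : IsSoFamily n c g)
    (hgen : Algebra.adjoin R (g '' Set.Icc 2 n) = ⊤) :
    Submodule.span R (Set.range (orderedMonomial (root t t' g) n)) = ⊤ := by
  set S := columnsSpan R (root t t' g) n 1 n with hS
  have hone : (1 : A) ∈ S := by
    rw [← Submodule.one_le]
    refine one_le_list_prod _ fun T hT => ?_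
    obtain ⟨l, -, rfl⟩ := List.mem_map.1 hT
    refine one_le_list_prod _ fun T hT => ?_
    obtain ⟨k, -, rfl⟩ := List.mem_map.1 hT
    exact one_le_powSpan _
  have hmul : ∀ a : A, ∀ s ∈ S, a * s ∈ S := by
    intro a
    have ha : a ∈ Algebra.adjoin R (g '' Set.Icc 2 n) := hgen ▸ Algebra.mem_top
    induction ha using Algebra.adjoin_induction with
    | mem a ha =>
      obtain ⟨j, ⟨hj, hjn⟩, rfl⟩ := ha
      intro s hs
      exact span_singleton_mul_columnsSpan_le h hc hu hg n le_rfl (by omega) (by omega) hjn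
        (Submodule.mul_mem_mul (Submodule.mem_span_singleton_self _) hs)
    | algebraMap r =>
      intro s hs
      rw [← Algebra.smul_def]
      exact Submodule.smul_mem _ _ hs
    | add a b _ _ ha hb =>
      intro s hs
      rw [add_mul]
      exact add_mem (ha s hs) (hb s hs)
    | mul a b _ _ ha hb =>
      intro s hs
      rw [mul_assoc]
      exact ha _ (hb s hs)
  have hle : S ≤ Submodule.span R (Set.range (orderedMonomial (root t t' g) n)) := by
    have hflat : S = ((pairs n).map fun p => powSpan R (root t t' g p.1 p.2)).prod := by
      rw [hS, columnsSpan, pairs, List.map_flatMap, List.flatMap_def, List.prod_flatten,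
        List.map_map]
      simp only [Function.comp_def, List.map_map]
    rw [hflat]
    refine (list_prod_powSpan_le (fun p : ℕ × ℕ => root t t' g p.1 p.2) _ (nodup_pairs n)).trans
      (Submodule.span_mono ?_)
    rintro _ ⟨e, rfl⟩
    refine ⟨fun i => e i.1, ?_⟩
    simp only [orderedMonomial]
    congr 1
    refine List.map_congr_left fun p hp => ?_
    rw [expo_pair e hp]
  rw [eq_top_iff]
  intro a _
  simpa using hle (hmul a 1 hone)

end Spanning

/-! ### The coaction by the vector representation -/

section Coaction

variable {R : Type*} [CommRing R] {A : Type*} [Ring A] [Algebra R A]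

/-- The operator by which `I_{k+1,k}` acts on the tensor product of a module with the vector
representation. Column vectors are functions `ℕ → A`, the element `a` is the action of `I_{k+1,k}` on
the module; only the rows `k` and `k + 1` differ from the diagonal action of `a`. -/
def coactOp (t t' : R) (a : A) (k : ℕ) : Module.End R (ℕ → A) where
  toFun f i :=
    if i = k then t' ^ 2 • (a * f k) + f (k + 1)
    else if i = k + 1 then t ^ 2 • (a * f (k + 1)) - f k
    else a * f i
  map_add' f f' := by
    funext i
    simp only [Pi.add_apply, mul_add, smul_add]
    split_ifs <;> abel
  map_smul' r f := by
    funext i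
    simp only [Pi.smul_apply, RingHom.id_apply, mul_smul_comm]
    split_ifs <;> simp only [smul_add, smul_sub, smul_comm r]

theorem coactOp_apply (t t' : R) (a : A) (k : ℕ) (f : ℕ → A) (i : ℕ) :
    coactOp t t' a k f i =
      if i = k then t' ^ 2 • (a * f k) + f (k + 1)
      else if i = k + 1 then t ^ 2 • (a * f (k + 1)) - f k
      else a * f i := rfl

variable {t t' c : R} {g : ℕ → A} {n : ℕ}

/-- All four kinds of rows reduce to the relation `hab` once `a a b` is rewritten by it. -/
theorem cubicRel_coactOp_left (h : t * t' = 1) (hc : c = t ^ 2 + t' ^ 2) {a b : A}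
    (hab : CubicRel c a b) (k : ℕ) :
    CubicRel c (coactOp t t' a k) (coactOp t t' b (k + 1)) := by
  have hab' : ∀ w, a * (a * (b * w)) = c • (a * (b * (a * w))) - b * (a * (a * w)) - b * w :=
    fun w => by
      have e : a ^ 2 * b - c • (a * b * a) + b * a ^ 2 = -b := hab
      have e := congrArg (· * w) e
      simp only [pow_two, add_mul, sub_mul, smul_mul_assoc, mul_assoc, neg_mul] at e
      linear_combination (norm := module) e
  subst hc
  refine LinearMap.ext fun f => funext fun i => ?_
  simp only [pow_two, LinearMap.add_apply, LinearMap.sub_apply, LinearMap.smul_apply,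
    LinearMap.neg_apply, Module.End.mul_apply, Pi.add_apply, Pi.sub_apply, Pi.smul_apply,
    Pi.neg_apply, coactOp_apply]
  have n1 : k ≠ k + 1 + 1 := by omega
  have n2 : k + 1 + 1 ≠ k := by omega
  rcases eq_or_ne i k with h0 | h0
  · simp [h0, n1, n2, mul_add, mul_sub, hab', smul_sub, smul_add]
    match_scalars <;> grind
  rcases eq_or_ne i (k + 1) with h1 | h1
  · simp [h1, n1, n2, mul_add, mul_sub, hab', smul_sub, smul_add]
    match_scalars <;> grind
  rcases eq_or_ne i (k + 1 + 1) with h2 | h2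
  · simp [h2, n2, mul_sub, hab', smul_sub]
    match_scalars <;> grind
  · simp [h0, h1, h2, hab']
    match_scalars <;> grind

theorem cubicRel_coactOp_right (h : t * t' = 1) (hc : c = t ^ 2 + t' ^ 2) {a b : A}
    (hab : CubicRel c b a) (k : ℕ) :
    CubicRel c (coactOp t t' b (k + 1)) (coactOp t t' a k) := by
  have hab' : ∀ w, b * (b * (a * w)) = c • (b * (a * (b * w))) - a * (b * (b * w)) - a * w :=
    fun w => by
      have e : b ^ 2 * a - c • (b * a * b) + a * b ^ 2 = -a := hab
      have e := congrArg (· * w) e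
      simp only [pow_two, add_mul, sub_mul, smul_mul_assoc, mul_assoc, neg_mul] at e
      linear_combination (norm := module) e
  subst hc
  refine LinearMap.ext fun f => funext fun i => ?_
  simp only [pow_two, LinearMap.add_apply, LinearMap.sub_apply, LinearMap.smul_apply,
    LinearMap.neg_apply, Module.End.mul_apply, Pi.add_apply, Pi.sub_apply, Pi.smul_apply,
    Pi.neg_apply, coactOp_apply]
  have n1 : k ≠ k + 1 + 1 := by omega
  have n2 : k + 1 + 1 ≠ k := by omega
  rcases eq_or_ne i k with h0 | h0
  · simp [h0, n1, mul_add, hab', smul_sub, smul_add]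
    match_scalars <;> grind
  rcases eq_or_ne i (k + 1) with h1 | h1
  · simp [h1, n1, n2, mul_add, mul_sub, hab', smul_sub, smul_add]
    match_scalars <;> grind
  rcases eq_or_ne i (k + 1 + 1) with h2 | h2
  · simp [h2, n1, n2, mul_add, mul_sub, hab', smul_sub, smul_add]
    match_scalars <;> grind
  · simp [h0, h1, h2, hab']
    match_scalars <;> grind

theorem commute_coactOp {a b : A} (hab : Commute a b) {k l : ℕ} (hkl : k + 1 < l) :
    Commute (coactOp t t' a k) (coactOp t t' b l) := by
  have hab' : ∀ w, b * (a * w) = a * (b * w) := fun w => by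
    rw [← mul_assoc, ← hab.eq, mul_assoc]
  refine LinearMap.ext fun f => funext fun i => ?_
  simp only [Module.End.mul_apply, coactOp_apply]
  have h1 : k ≠ l := by omega
  have h2 : k + 1 ≠ l := by omega
  have h3 : k ≠ l + 1 := by omega
  rcases eq_or_ne i k with rfl | h4
  · simp [h1, h2, h3, mul_add, hab']
  rcases eq_or_ne i (k + 1) with rfl | h5
  · simp [h1, h2, h3, mul_sub, hab']
  rcases eq_or_ne i l with rfl | h6
  · simp [h1.symm, h2.symm, h3.symm, mul_add, hab']
  rcases eq_or_ne i (l + 1) with rfl | h7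
  · simp [h1.symm, h2.symm, h3.symm, mul_sub, hab']
  · simp [h4, h5, h6, h7, hab']

/-- The tensor product with the vector representation is again a representation. -/
theorem IsSoFamily.coact (h : t * t' = 1) (hc : c = t ^ 2 + t' ^ 2) (hg : IsSoFamily n c g) :
    IsSoFamily n c fun k => coactOp t t' (g k) (k - 1) where
  left i hi hin := by
    obtain ⟨k, rfl⟩ : ∃ k, i = k + 1 := ⟨i - 1, by omega⟩
    exact cubicRel_coactOp_left h hc (hg.left _ hi hin) k
  right i hi hin := by
    obtain ⟨k, rfl⟩ : ∃ k, i = k + 1 := ⟨i - 1, by omega⟩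
    exact cubicRel_coactOp_right h hc (hg.right _ hi hin) k
  comm i j hi hij hj := commute_coactOp (hg.comm i j hi hij hj) (by omega)

end Coaction

/-! ### The universal algebra over a commutative ring -/

section Universal

variable {R : Type*} [CommRing R]

/-- The defining relations of `U'_q(so_n)` over a commutative ring, with `c` in place of
`q + q⁻¹`. -/
inductive UnivRel (n : ℕ) (c : R) : FreeAlgebra R (Gen n) → FreeAlgebra R (Gen n) → Prop
  | left (i j : Gen n) (h : j.1 = i.1 + 1) : UnivRel n c
      (FreeAlgebra.ι R i ^ 2 * FreeAlgebra.ι R j -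
        c • (FreeAlgebra.ι R i * FreeAlgebra.ι R j * FreeAlgebra.ι R i) +
        FreeAlgebra.ι R j * FreeAlgebra.ι R i ^ 2) (-FreeAlgebra.ι R j)
  | right (i j : Gen n) (h : j.1 = i.1 + 1) : UnivRel n c
      (FreeAlgebra.ι R j ^ 2 * FreeAlgebra.ι R i -
        c • (FreeAlgebra.ι R j * FreeAlgebra.ι R i * FreeAlgebra.ι R j) +
        FreeAlgebra.ι R i * FreeAlgebra.ι R j ^ 2) (-FreeAlgebra.ι R i)
  | comm (i j : Gen n) (h : i.1 + 1 < j.1) : UnivRel n c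
      (FreeAlgebra.ι R i * FreeAlgebra.ι R j) (FreeAlgebra.ι R j * FreeAlgebra.ι R i)

/-- The algebra `U'_q(so_n)` over a commutative ring, with `c` in place of `q + q⁻¹`. -/
abbrev Univ (n : ℕ) (c : R) : Type _ := RingQuot (UnivRel n c)

/-- The generator `I_{k,k-1}` of the universal algebra, zero outside the range of labels. -/
noncomputable def univGen (n : ℕ) (c : R) (k : ℕ) : Univ n c :=
  if h : 2 ≤ k ∧ k ≤ n then RingQuot.mkAlgHom R (UnivRel n c) (FreeAlgebra.ι R ⟨k, h⟩) else 0

theorem univGen_of_mem {n k : ℕ} (c : R) (h : 2 ≤ k ∧ k ≤ n) :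
    univGen n c k = RingQuot.mkAlgHom R (UnivRel n c) (FreeAlgebra.ι R ⟨k, h⟩) := dif_pos h

theorem isSoFamily_univGen (n : ℕ) (c : R) : IsSoFamily n c (univGen n c) where
  left i hi hin := by
    rw [univGen_of_mem c ⟨hi, by omega⟩, univGen_of_mem c ⟨by omega, hin⟩, CubicRel]
    simpa using RingQuot.mkAlgHom_rel R (UnivRel.left (c := c) (n := n) ⟨i, _⟩ ⟨i + 1, _⟩ rfl)
  right i hi hin := by
    rw [univGen_of_mem c ⟨hi, by omega⟩, univGen_of_mem c ⟨by omega, hin⟩, CubicRel]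
    simpa using RingQuot.mkAlgHom_rel R (UnivRel.right (c := c) (n := n) ⟨i, _⟩ ⟨i + 1, _⟩ rfl)
  comm i j hi hij hj := by
    rw [univGen_of_mem c ⟨hi, by omega⟩, univGen_of_mem c ⟨by omega, hj⟩, Commute, SemiconjBy]
    simpa using RingQuot.mkAlgHom_rel R (UnivRel.comm (c := c) (n := n) ⟨i, _⟩ ⟨j, _⟩ hij)

theorem adjoin_univGen (n : ℕ) (c : R) :
    Algebra.adjoin R (univGen n c '' Set.Icc 2 n) = ⊤ := by
  have h : (RingQuot.mkAlgHom R (UnivRel n c)).range = ⊤ :=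
    (AlgHom.range_eq_top _).2 (RingQuot.mkAlgHom_surjective R (UnivRel n c))
  rw [eq_top_iff, ← h, ← Algebra.map_top, ← FreeAlgebra.adjoin_range_ι, AlgHom.map_adjoin]
  refine Algebra.adjoin_mono ?_
  rintro _ ⟨_, ⟨k, rfl⟩, rfl⟩
  exact ⟨k.1, k.2, univGen_of_mem c k.2⟩

variable {A : Type*} [Ring A] [Algebra R A] {t t' c : R} {g : ℕ → A} {n : ℕ}

/-- The homomorphism from the universal algebra given by a family satisfying the relations. -/
noncomputable def univLift (hg : IsSoFamily n c g) : Univ n c →ₐ[R] A :=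
  RingQuot.liftAlgHom R ⟨FreeAlgebra.lift R fun k : Gen n => g k, by
    rintro _ _ (⟨i, j, h⟩ | ⟨i, j, h⟩ | ⟨i, j, h⟩)
    · have := hg.left i i.2.1 (h ▸ j.2.2)
      rw [← h, CubicRel] at this
      simpa using this
    · have := hg.right i i.2.1 (h ▸ j.2.2)
      rw [← h, CubicRel] at this
      simpa using this
    · simpa using (hg.comm i j i.2.1 h j.2.2).eq⟩

theorem univLift_univGen (hg : IsSoFamily n c g) {k : ℕ} (hk : 2 ≤ k) (hkn : k ≤ n) :
    univLift hg (univGen n c k) = g k := by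
  rw [univGen_of_mem c ⟨hk, hkn⟩, univLift, RingQuot.liftAlgHom_mkAlgHom_apply,
    FreeAlgebra.lift_ι_apply]

theorem IsSoFamily.map {B : Type*} [Ring B] [Algebra R B] (hg : IsSoFamily n c g) (f : A →ₐ[R] B) :
    IsSoFamily n c fun k => f (g k) where
  left i hi hin := by simpa [CubicRel] using congrArg f (hg.left i hi hin)
  right i hi hin := by simpa [CubicRel] using congrArg f (hg.right i hi hin)
  comm i j hi hij hj := (hg.comm i j hi hij hj).map f

theorem map_root {B : Type*} [Ring B] [Algebra R B] (f : A →ₐ[R] B) {g' : ℕ → B}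
    (hg : ∀ k, 2 ≤ k → k ≤ n → f (g k) = g' k) {k l : ℕ} (hl : 1 ≤ l) (hlk : l < k) (hk : k ≤ n) :
    f (root t t' g k l) = root t t' g' k l := by
  revert hl
  refine root_induction (P := fun l => 1 ≤ l → f (root t t' g k l) = root t t' g' k l)
    (fun l hk' hl => ?_) (fun l hlk ih hl => ?_) l hlk
  · rw [root_of_not_lt (by omega), root_of_not_lt (by omega), hg k (by omega) hk]
  · rw [root_of_lt hlk, root_of_lt hlk, bracket, bracket, map_sub, map_smul, map_smul, map_mul,
      map_mul, ih (by omega), hg _ (by omega) (by omega)]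

theorem map_orderedMonomial {B : Type*} [Ring B] [Algebra R B] (f : A →ₐ[R] B) {g' : ℕ → B}
    (hg : ∀ k, 2 ≤ k → k ≤ n → f (g k) = g' k) (m : Pair n → ℕ) :
    f (orderedMonomial (root t t' g) n m) = orderedMonomial (root t t' g') n m := by
  rw [orderedMonomial, orderedMonomial, map_list_prod, List.map_map]
  congr 1
  refine List.map_congr_left fun p hp => ?_
  obtain ⟨h1, h2, h3⟩ := mem_pairs.1 hp
  rw [Function.comp_apply, map_pow, map_root f hg h1 h2 h3]

/-- Roots formed over a ring `R` agree with those formed over an `R`-algebra `S`. -/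
theorem root_algebraMap {S : Type*} [CommRing S] [Algebra R S] [Algebra S A] [IsScalarTower R S A]
    (t t' : R) (g : ℕ → A) (k l : ℕ) :
    root (algebraMap R S t) (algebraMap R S t') g k l = root t t' g k l := by
  by_cases h : l + 1 < k
  · rw [root_of_lt h, root_of_lt h, root_algebraMap t t' g k (l + 1)]
    simp only [bracket, algebraMap_smul]
  · rw [root_of_not_lt h, root_of_not_lt h]
termination_by k - l

theorem isSoFamily_algebraMap_iff {S : Type*} [CommRing S] [Algebra R S] [Algebra S A]
    [IsScalarTower R S A] : IsSoFamily n (algebraMap R S c) g ↔ IsSoFamily n c g := by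
  constructor <;> rintro ⟨h1, h2, h3⟩ <;>
    exact ⟨by simpa only [CubicRel, algebraMap_smul] using h1,
      by simpa only [CubicRel, algebraMap_smul] using h2, h3⟩

/-! ### Matrix coefficients of tensor powers of the vector representation -/

/-- The coaction: the action of the universal algebra on column vectors over itself. -/
noncomputable def coact (n : ℕ) (h : t * t' = 1) (hc : c = t ^ 2 + t' ^ 2) :
    Univ n c →ₐ[R] Module.End R (ℕ → Univ n c) :=
  univLift ((isSoFamily_univGen n c).coact h hc)

theorem coact_univGen (h : t * t' = 1) (hc : c = t ^ 2 + t' ^ 2) {k : ℕ} (hk : 2 ≤ k) (hkn : k ≤ n) :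
    coact n h hc (univGen n c k) = coactOp t t' (univGen n c k) (k - 1) :=
  univLift_univGen _ hk hkn

theorem isSoFamily_zero (n : ℕ) (c : R) : IsSoFamily n c (fun _ => (0 : R)) where
  left i _ _ := by simp [CubicRel]
  right i _ _ := by simp [CubicRel]
  comm i j _ _ _ := Commute.zero_left _

/-- The trivial representation. -/
noncomputable def counit (n : ℕ) (c : R) : Univ n c →ₐ[R] R := univLift (isSoFamily_zero n c)

/-- The matrix coefficient, in a tensor power of the vector representation, whose rows and columns
are given by a list of pairs `(k, l)`: the row is `l` and the column is `k`. The empty list gives the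
trivial representation. -/
noncomputable def coeffFun (n : ℕ) (h : t * t' = 1) (hc : c = t ^ 2 + t' ^ 2) :
    List (ℕ × ℕ) → Univ n c →ₗ[R] R
  | [] => (counit n c).toLinearMap
  | p :: ps => coeffFun n h hc ps ∘ₗ LinearMap.proj p.2 ∘ₗ
      LinearMap.applyₗ (Pi.single p.1 1) ∘ₗ (coact n h hc).toLinearMap

theorem coeffFun_nil (h : t * t' = 1) (hc : c = t ^ 2 + t' ^ 2) (u : Univ n c) :
    coeffFun n h hc [] u = counit n c u := rfl

theorem coeffFun_cons (h : t * t' = 1) (hc : c = t ^ 2 + t' ^ 2) (p : ℕ × ℕ) (ps : List (ℕ × ℕ))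
    (u : Univ n c) :
    coeffFun n h hc (p :: ps) u = coeffFun n h hc ps (coact n h hc u (Pi.single p.1 1) p.2) := rfl

section BaseChange

variable {S : Type*} [CommRing S] [Algebra R S] {t₁ t₁' c₁ : S}

/-- The base change homomorphism between universal algebras. -/
noncomputable def univMap (n : ℕ) (hc₁ : algebraMap R S c = c₁) : Univ n c →ₐ[R] Univ n c₁ :=
  univLift (g := univGen n c₁)
    ((isSoFamily_algebraMap_iff (S := S)).1 (by rw [hc₁]; exact isSoFamily_univGen n c₁))

theorem univMap_univGen (hc₁ : algebraMap R S c = c₁) {k : ℕ} (hk : 2 ≤ k) (hkn : k ≤ n) :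
    univMap n hc₁ (univGen n c k) = univGen n c₁ k := univLift_univGen _ hk hkn

/-- The coaction is compatible with base change. -/
theorem univMap_coact (h : t * t' = 1) (hc : c = t ^ 2 + t' ^ 2) (h₁ : t₁ * t₁' = 1)
    (hc₁ : c₁ = t₁ ^ 2 + t₁' ^ 2) (ht : algebraMap R S t = t₁) (ht' : algebraMap R S t' = t₁')
    (hcc : algebraMap R S c = c₁) (u : Univ n c) (f : ℕ → Univ n c) :
    univMap n hcc ∘ (coact n h hc u f) = coact n h₁ hc₁ (univMap n hcc u) (univMap n hcc ∘ f) := by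
  have hu : u ∈ Algebra.adjoin R (univGen n c '' Set.Icc 2 n) := adjoin_univGen n c ▸ Algebra.mem_top
  induction hu using Algebra.adjoin_induction generalizing f with
  | mem u hu =>
    obtain ⟨k, ⟨hk, hkn⟩, rfl⟩ := hu
    rw [univMap_univGen _ hk hkn, coact_univGen h hc hk hkn, coact_univGen h₁ hc₁ hk hkn]
    funext i
    simp only [Function.comp_apply, coactOp_apply]
    split_ifs <;>
      simp only [map_add, map_sub, map_smul, map_mul, univMap_univGen _ hk hkn, ← ht, ← ht',
        ← map_pow, algebraMap_smul]
  | algebraMap r =>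
    rw [Algebra.algebraMap_eq_smul_one, map_smul, map_smul, map_one, map_one,
      ← algebraMap_smul S r (1 : Univ n c₁), map_smul, map_one]
    funext i
    simp only [Function.comp_apply, LinearMap.smul_apply, Pi.smul_apply, Module.End.one_apply,
      map_smul, algebraMap_smul]
  | add u v _ _ hu hv =>
    funext i
    have hu' := congrFun (hu f) i
    have hv' := congrFun (hv f) i
    simp only [Function.comp_apply] at hu' hv'
    simp only [map_add, LinearMap.add_apply, Function.comp_apply, Pi.add_apply, hu', hv']
  | mul u v _ _ hu hv =>
    rw [map_mul, map_mul, map_mul, Module.End.mul_apply, Module.End.mul_apply, hu, hv]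

theorem coeffFun_univMap (h : t * t' = 1) (hc : c = t ^ 2 + t' ^ 2) (h₁ : t₁ * t₁' = 1)
    (hc₁ : c₁ = t₁ ^ 2 + t₁' ^ 2) (ht : algebraMap R S t = t₁) (ht' : algebraMap R S t' = t₁')
    (hcc : algebraMap R S c = c₁) (ps : List (ℕ × ℕ)) (u : Univ n c) :
    coeffFun n h₁ hc₁ ps (univMap n hcc u) = algebraMap R S (coeffFun n h hc ps u) := by
  induction ps generalizing u with
  | nil =>
    rw [coeffFun_nil, coeffFun_nil]
    have hu : u ∈ Algebra.adjoin R (univGen n c '' Set.Icc 2 n) :=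
      adjoin_univGen n c ▸ Algebra.mem_top
    induction hu using Algebra.adjoin_induction with
    | mem u hu =>
      obtain ⟨k, ⟨hk, hkn⟩, rfl⟩ := hu
      rw [univMap_univGen _ hk hkn, counit, counit, univLift_univGen _ hk hkn,
        univLift_univGen _ hk hkn, map_zero]
    | algebraMap r =>
      rw [AlgHom.commutes, IsScalarTower.algebraMap_apply R S, AlgHom.commutes, AlgHom.commutes]
      rfl
    | add u v _ _ hu hv => simp only [map_add, hu, hv]
    | mul u v _ _ hu hv => simp only [map_mul, hu, hv]
  | cons p ps ih =>
    rw [coeffFun_cons, coeffFun_cons, ← ih]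
    congr 1
    have e := congrFun (univMap_coact h hc h₁ hc₁ ht ht' hcc u (Pi.single p.1 1)) p.2
    rw [Function.comp_apply] at e
    have hs : univMap n hcc ∘ Pi.single p.1 1 = Pi.single p.1 1 := by
      funext i
      rw [Function.comp_apply, Pi.single_apply, Pi.single_apply]
      split_ifs <;> simp
    rw [e, hs]

end BaseChange

end Universal

/-! ### Ordered monomials as words -/

section Words

/-- All words obtained from `w` by deleting one occurrence of `p`, with multiplicity. -/
def deletions {ι : Type*} [DecidableEq ι] (p : ι) : List ι → List (List ι)
  | [] => []
  | q :: w => (if q = p then [w] else []) ++ (deletions p w).map (q :: ·)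

/-- The number of ways to delete the letters of the first word one after another from the second
word, ending with the empty word. -/
def deletionCount {ι : Type*} [DecidableEq ι] : List ι → List ι → ℕ
  | [], w => if w = [] then 1 else 0
  | p :: ps, w => ((deletions p w).map (deletionCount ps)).sum

variable {ι : Type*} [DecidableEq ι]

theorem perm_cons_of_mem_deletions {p : ι} {w v : List ι} (hv : v ∈ deletions p w) :
    w.Perm (p :: v) := by
  induction w generalizing v with
  | nil => simp [deletions] at hv
  | cons q w ih =>
    rw [deletions, List.mem_append, List.mem_map] at hv
    rcases hv with hv | ⟨u, hu, rfl⟩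
    · split_ifs at hv with hq
      · rw [List.mem_singleton] at hv
        rw [hv, hq]
      · simp at hv
    · exact ((ih hu).cons q).trans (List.Perm.swap _ _ _)

theorem exists_mem_deletions {p : ι} {w : List ι} (hp : p ∈ w) : ∃ v, v ∈ deletions p w := by
  induction w with
  | nil => simp at hp
  | cons q w ih =>
    by_cases hq : q = p
    · exact ⟨w, by simp [deletions, hq]⟩
    · obtain ⟨v, hv⟩ := ih ((List.mem_cons.1 hp).resolve_left (Ne.symm hq))
      exact ⟨q :: v, by simp [deletions, hq, hv]⟩

theorem deletionCount_ne_zero_iff {ps w : List ι} : deletionCount ps w ≠ 0 ↔ ps.Perm w := by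
  induction ps generalizing w with
  | nil => simp [deletionCount]
  | cons p ps ih =>
    have hsum : deletionCount (p :: ps) w ≠ 0 ↔ ∃ v ∈ deletions p w, ps.Perm v := by
      rw [deletionCount, Ne, List.sum_eq_zero_iff]
      simp [← ih]
    rw [hsum]
    constructor
    · rintro ⟨v, hv, hps⟩
      exact (hps.cons p).trans (perm_cons_of_mem_deletions hv).symm
    · intro h
      obtain ⟨v, hv⟩ := exists_mem_deletions (h.subset List.mem_cons_self)
      exact ⟨v, hv, (h.trans (perm_cons_of_mem_deletions hv)).cons_inv⟩

/-- The ordered word in which the letter `p` occurs `m p` times. -/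
def orderedWord {n : ℕ} (m : Pair n → ℕ) : List (ℕ × ℕ) :=
  (pairs n).flatMap fun p => List.replicate (expo m p.1 p.2) p

theorem mem_pairs_of_mem_orderedWord {n : ℕ} {m : Pair n → ℕ} {p : ℕ × ℕ}
    (hp : p ∈ orderedWord m) : p ∈ pairs n := by
  obtain ⟨q, hq, hpq⟩ := List.mem_flatMap.1 hp
  rwa [List.eq_of_mem_replicate hpq]

theorem count_flatMap_replicate {κ : Type*} [BEq κ] [LawfulBEq κ] (e : κ → ℕ)
    {L : List κ} (hL : L.Nodup) (p : κ) (hp : p ∈ L) :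
    (L.flatMap fun q => List.replicate (e q) q).count p = e p := by
  induction L with
  | nil => simp at hp
  | cons q L ih =>
    rw [List.nodup_cons] at hL
    rw [List.flatMap_cons, List.count_append]
    by_cases hq : p = q
    · subst hq
      have h0 : (L.flatMap fun q => List.replicate (e q) q).count p = 0 := by
        refine List.count_eq_zero.2 fun h => hL.1 ?_
        obtain ⟨r, hr, hpr⟩ := List.mem_flatMap.1 h
        rwa [List.eq_of_mem_replicate hpr]
      rw [h0, List.count_replicate_self, add_zero]
    · rw [ih hL.2 ((List.mem_cons.1 hp).resolve_left hq), List.count_replicate]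
      simp [Ne.symm hq]

theorem eq_of_perm_orderedWord {n : ℕ} {m m' : Pair n → ℕ}
    (h : (orderedWord m).Perm (orderedWord m')) : m = m' := by
  funext p
  have hp : p.1 ∈ pairs n := mem_pairs.2 p.2
  have h1 := h.count_eq p.1
  rw [orderedWord, orderedWord,
    count_flatMap_replicate (fun p : ℕ × ℕ => expo m p.1 p.2) (nodup_pairs n) _ hp,
    count_flatMap_replicate (fun p : ℕ × ℕ => expo m' p.1 p.2) (nodup_pairs n) _ hp] at h1
  simpa only [expo, dif_pos p.2] using h1

/-- The product of a family along a word. -/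
def wordProd {A : Type*} [Ring A] (X : ℕ → ℕ → A) (w : List (ℕ × ℕ)) : A :=
  (w.map fun p => X p.1 p.2).prod

theorem orderedMonomial_eq_wordProd {A : Type*} [Ring A] (X : ℕ → ℕ → A) {n : ℕ} (m : Pair n → ℕ) :
    orderedMonomial X n m = wordProd X (orderedWord m) := by
  rw [orderedMonomial, wordProd, orderedWord, List.map_flatMap, List.flatMap_def,
    List.prod_flatten, List.map_map]
  simp [Function.comp_def]

end Words

/-! ### Matrix coefficients of ordered monomials at `q = 1` -/

section Classical

variable {R : Type*} [CommRing R] {c : R} {n : ℕ}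

/-- The elements `I_{kl}` of the universal algebra at `q^{1/2} = 1`. -/
noncomputable abbrev classicalRoot (n : ℕ) (c : R) : ℕ → ℕ → Univ n c :=
  root (1 : R) 1 (univGen n c)

/-- At `q = 1` the element `I_{kl}` acts on a tensor product with the vector representation as a
primitive element: it acts on the two factors separately. -/
theorem root_coactOp_one {A : Type*} [Ring A] [Algebra R A] (g : ℕ → A) {k l : ℕ} (hlk : l < k)
    (f : ℕ → A) (i : ℕ) :
    root (1 : R) 1 (fun j => coactOp (1 : R) 1 (g j) (j - 1)) k l f i =
      root (1 : R) 1 g k l * f i +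
        (if i = l then f k else if i = k then (-1 : R) • f l else 0) := by
  have hG : ∀ (l : ℕ) (f : ℕ → A) (i : ℕ), coactOp (1 : R) 1 (g (l + 1)) l f i =
      g (l + 1) * f i + (if i = l then f (l + 1) else if i = l + 1 then (-1 : R) • f l else 0) := by
    intro l f i
    rw [coactOp_apply]
    rcases eq_or_ne i l with h0 | h0
    · simp [h0]
    rcases eq_or_ne i (l + 1) with h1 | h1
    · simp [h1, sub_eq_add_neg]
    · simp [h0, h1]
  revert f i
  refine root_induction (P := fun l => ∀ (f : ℕ → A) (i : ℕ),
    root (1 : R) 1 (fun j => coactOp (1 : R) 1 (g j) (j - 1)) k l f i =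
      root (1 : R) 1 g k l * f i +
        (if i = l then f k else if i = k then (-1 : R) • f l else 0))
    (fun l hlk f i => ?_) (fun l hlk ih f i => ?_) l hlk
  · subst hlk
    rw [root_succ_self, root_succ_self]
    exact hG l f i
  · rw [root_of_lt hlk, root_of_lt hlk]
    simp only [bracket, one_smul, LinearMap.sub_apply, Module.End.mul_apply, Pi.sub_apply,
      Nat.add_sub_cancel, hG, ih]
    have h1 : k ≠ l := by omega
    have h2 : k ≠ l + 1 := by omega
    rcases eq_or_ne i l with h3 | h3
    · simp [h3, h1.symm, mul_add, sub_mul, mul_assoc]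
      abel
    rcases eq_or_ne i (l + 1) with h4 | h4
    · simp [h4, h1, h1.symm, h2, h2.symm, mul_add, sub_mul, mul_assoc]
      abel
    rcases eq_or_ne i k with h5 | h5
    · simp [h5, h1, h2, mul_add, sub_mul, mul_assoc]
      abel
    · simp [h3, h4, h5, sub_mul, mul_assoc]

theorem coact_classicalRoot (hc : c = 1 ^ 2 + 1 ^ 2) {k l : ℕ} (hl : 1 ≤ l) (hlk : l < k)
    (hk : k ≤ n) (f : ℕ → Univ n c) (i : ℕ) :
    coact n (one_mul 1) hc (classicalRoot n c k l) f i = classicalRoot n c k l * f i +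
      (if i = l then f k else if i = k then (-1 : R) • f l else 0) := by
  rw [classicalRoot, map_root (coact n (one_mul 1) hc)
    (g' := fun j => coactOp (1 : R) 1 (univGen n c j) (j - 1))
    (fun k hk hkn => coact_univGen _ hc hk hkn) hl hlk hk]
  exact root_coactOp_one _ hlk f i

/-- The span of the products of fewer than `d` elements `I_{kl}`, at `q = 1`. -/
noncomputable def degreeLT (n : ℕ) (c : R) (d : ℕ) : Submodule R (Univ n c) :=
  Submodule.span R {u | ∃ w : List (ℕ × ℕ), (∀ p ∈ w, p ∈ pairs n) ∧ w.length < d ∧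
    u = wordProd (classicalRoot n c) w}

theorem wordProd_mem_degreeLT {w : List (ℕ × ℕ)} (hw : ∀ p ∈ w, p ∈ pairs n) {d : ℕ}
    (hd : w.length < d) : wordProd (classicalRoot n c) w ∈ degreeLT n c d :=
  Submodule.subset_span ⟨w, hw, hd, rfl⟩

theorem degreeLT_zero : degreeLT n c 0 = ⊥ := by
  simp [degreeLT]

theorem degreeLT_mono {d d' : ℕ} (h : d ≤ d') : degreeLT n c d ≤ degreeLT n c d' := by
  refine Submodule.span_mono ?_
  rintro _ ⟨w, hw, hd, rfl⟩
  exact ⟨w, hw, by omega, rfl⟩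

theorem wordProd_cons {A : Type*} [Ring A] (X : ℕ → ℕ → A) (p : ℕ × ℕ) (w : List (ℕ × ℕ)) :
    wordProd X (p :: w) = X p.1 p.2 * wordProd X w := by
  simp [wordProd]

theorem root_mul_mem_degreeLT {p : ℕ × ℕ} (hp : p ∈ pairs n) {d : ℕ} {u : Univ n c}
    (hu : u ∈ degreeLT n c (d - 1)) : classicalRoot n c p.1 p.2 * u ∈ degreeLT n c d := by
  cases d with
  | zero =>
    rw [degreeLT_zero, Submodule.mem_bot] at hu
    rw [hu, mul_zero]
    exact zero_mem _
  | succ d =>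
    rw [Nat.add_sub_cancel] at hu
    induction hu using Submodule.span_induction with
    | mem u hu =>
      obtain ⟨w, hw, hd, rfl⟩ := hu
      rw [← wordProd_cons]
      refine wordProd_mem_degreeLT ?_ (by simpa using hd)
      simpa [hp] using hw
    | zero => simp
    | add u v _ _ hu hv => rw [mul_add]; exact add_mem hu hv
    | smul r u _ hu => rw [mul_smul_comm]; exact Submodule.smul_mem _ _ hu

/-- Up to lower degree, the coaction on a word is diagonal. -/
theorem coact_wordProd_sub_mem (hc : c = 1 ^ 2 + 1 ^ 2) {w : List (ℕ × ℕ)}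
    (hw : ∀ p ∈ w, p ∈ pairs n) (k i : ℕ) :
    coact n (one_mul 1) hc (wordProd (classicalRoot n c) w) (Pi.single k 1) i -
      (if i = k then wordProd (classicalRoot n c) w else 0) ∈ degreeLT n c w.length := by
  induction w generalizing i with
  | nil =>
    simp only [wordProd, List.map_nil, List.prod_nil, map_one, Module.End.one_apply,
      Pi.single_apply, sub_self]
    exact zero_mem _
  | cons p w ih =>
    have hw' : ∀ q ∈ w, q ∈ pairs n := fun q hq => hw q (by simp [hq])
    have hp : p ∈ pairs n := hw p (by simp)
    obtain ⟨h1, h2, h3⟩ := mem_pairs.1 hp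
    specialize ih hw'
    have hmem : ∀ i, coact n (one_mul 1) hc (wordProd (classicalRoot n c) w) (Pi.single k 1) i ∈
        degreeLT n c (w.length + 1) := fun i => by
      rw [← sub_add_cancel (coact n (one_mul 1) hc _ _ i)
        (if i = k then wordProd (classicalRoot n c) w else 0)]
      refine add_mem (degreeLT_mono (Nat.le_succ _) (ih i)) ?_
      split_ifs
      · exact wordProd_mem_degreeLT hw' (Nat.lt_succ_self _)
      · exact zero_mem _
    rw [wordProd_cons, map_mul, Module.End.mul_apply, coact_classicalRoot hc h1 h2 h3,
      List.length_cons]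
    have e : (if i = k then classicalRoot n c p.1 p.2 * wordProd (classicalRoot n c) w else 0) =
        classicalRoot n c p.1 p.2 * (if i = k then wordProd (classicalRoot n c) w else 0) := by
      split_ifs <;> simp
    rw [e, add_sub_right_comm, ← mul_sub]
    refine add_mem (root_mul_mem_degreeLT hp (ih i)) ?_
    split_ifs
    · exact hmem _
    · exact Submodule.smul_mem _ _ (hmem _)
    · exact zero_mem _

/-- Taking the `(l, k)` entry of the coaction acts on words, up to lower degree, as the derivation
which deletes the letter `(k, l)`. -/
theorem coact_wordProd_sub_deletions_mem (hc : c = 1 ^ 2 + 1 ^ 2) {p : ℕ × ℕ} (hp : p ∈ pairs n)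
    {w : List (ℕ × ℕ)} (hw : ∀ q ∈ w, q ∈ pairs n) :
    coact n (one_mul 1) hc (wordProd (classicalRoot n c) w) (Pi.single p.1 1) p.2 -
      ((deletions p w).map (wordProd (classicalRoot n c))).sum ∈ degreeLT n c (w.length - 1) := by
  obtain ⟨k, l⟩ := p
  obtain ⟨hl, hlk, hk⟩ := mem_pairs.1 hp
  dsimp only at hl hlk hk ⊢
  induction w with
  | nil =>
    simp only [wordProd, List.map_nil, List.prod_nil, map_one, Module.End.one_apply,
      Pi.single_eq_of_ne hlk.ne, deletions, List.sum_nil, sub_self]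
    exact zero_mem _
  | cons q w ih =>
    have hw' : ∀ q ∈ w, q ∈ pairs n := fun q hq => hw q (by simp [hq])
    have hq : q ∈ pairs n := hw q (by simp)
    obtain ⟨h1, h2, h3⟩ := mem_pairs.1 hq
    specialize ih hw'
    have hA := coact_wordProd_sub_mem hc hw' k
    have hdel : ((deletions (k, l) (q :: w)).map (wordProd (classicalRoot n c))).sum =
        (if q = (k, l) then wordProd (classicalRoot n c) w else 0) +
          classicalRoot n c q.1 q.2 *
            ((deletions (k, l) w).map (wordProd (classicalRoot n c))).sum := by
      rw [deletions, List.map_append, List.sum_append, List.map_map, ← List.sum_map_mul_left]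
      congr 1
      · split_ifs <;> simp
    rw [hdel, wordProd_cons, map_mul, Module.End.mul_apply, coact_classicalRoot hc h1 h2 h3,
      List.length_cons, Nat.add_sub_cancel, add_comm (ite _ _ _), add_sub_add_comm, ← mul_sub]
    refine add_mem (root_mul_mem_degreeLT hq ih) ?_
    obtain ⟨k', l'⟩ := q
    dsimp only at h1 h2 h3 ⊢
    rcases eq_or_ne l l' with rfl | hll
    · have := hA k'
      rw [if_pos rfl]
      rcases eq_or_ne k' k with rfl | hkk
      · simpa using this
      · simpa [hkk] using this
    · have hne : (k', l') ≠ (k, l) := by simp [hll.symm]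
      rw [if_neg hll, if_neg hne, sub_zero]
      split_ifs with hlk'
      · have := hA l'
        rw [if_neg (by omega), sub_zero] at this
        exact Submodule.smul_mem _ _ this
      · exact zero_mem _

/-- If `w` is shorter than `ps`, then both sides vanish. -/
theorem coeffFun_wordProd (hc : c = 1 ^ 2 + 1 ^ 2) {ps : List (ℕ × ℕ)} (hps : ∀ p ∈ ps, p ∈ pairs n)
    {w : List (ℕ × ℕ)} (hw : ∀ p ∈ w, p ∈ pairs n) (hlen : w.length ≤ ps.length) :
    coeffFun n (one_mul 1) hc ps (wordProd (classicalRoot n c) w) = deletionCount ps w := by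
  induction ps generalizing w with
  | nil =>
    rw [List.length_nil, Nat.le_zero, List.length_eq_zero_iff] at hlen
    subst hlen
    simp [coeffFun_nil, wordProd, deletionCount]
  | cons p ps ih =>
    have hp : p ∈ pairs n := hps p (by simp)
    replace ih := @ih fun q hq => hps q (by simp [hq])
    rw [List.length_cons] at hlen
    have hzero : ∀ u ∈ degreeLT n c (w.length - 1), coeffFun n (one_mul 1) hc ps u = 0 := by
      intro u hu
      induction hu using Submodule.span_induction with
      | mem u hu =>
        obtain ⟨v, hv, hvd, rfl⟩ := hu
        rw [ih hv (by omega)]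
        have : deletionCount ps v = 0 := by
          by_contra h
          have := (deletionCount_ne_zero_iff.1 h).length_eq
          omega
        rw [this, Nat.cast_zero]
      | zero => exact map_zero _
      | add u v _ _ hu hv => rw [map_add, hu, hv, add_zero]
      | smul r u _ hu => rw [map_smul, hu, smul_zero]
    have hB := hzero _ (coact_wordProd_sub_deletions_mem hc hp hw)
    rw [map_sub, sub_eq_zero] at hB
    rw [coeffFun_cons, hB, map_list_sum, List.map_map, deletionCount, Nat.cast_list_sum,
      List.map_map]
    congr 1
    refine List.map_congr_left fun v hv => ?_
    have hperm := perm_cons_of_mem_deletions hv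
    have hlen' := hperm.length_eq
    rw [List.length_cons] at hlen'
    rw [Function.comp_apply, Function.comp_apply,
      ih (fun q hq => hw q (hperm.mem_iff.2 (by simp [hq]))) (by omega)]

/-- In characteristic zero, the matrix coefficients separate the ordered monomials at `q = 1`. -/
theorem eq_zero_of_coeffFun_eq_zero [IsDomain R] [CharZero R] (hc : c = 1 ^ 2 + 1 ^ 2)
    (a : (Pair n → ℕ) →₀ R)
    (ha : ∀ ps : List (ℕ × ℕ), (∀ p ∈ ps, p ∈ pairs n) → (a.sum fun m r =>
      r * coeffFun n (one_mul 1) hc ps (orderedMonomial (classicalRoot n c) n m)) = 0) : a = 0 := by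
  by_contra hne
  -- A monomial of maximal degree is detected by the coefficient belonging to its own word.
  obtain ⟨m₀, hm₀, hmax⟩ := a.support.exists_max_image (fun m => (orderedWord m).length)
    (Finsupp.support_nonempty_iff.2 hne)
  have h := ha (orderedWord m₀) fun p => mem_pairs_of_mem_orderedWord
  rw [Finsupp.sum, Finset.sum_eq_single_of_mem m₀ hm₀] at h
  · rw [orderedMonomial_eq_wordProd, coeffFun_wordProd hc (fun p => mem_pairs_of_mem_orderedWord)
      (fun p => mem_pairs_of_mem_orderedWord) le_rfl] at h
    rcases mul_eq_zero.1 h with h | h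
    · exact Finsupp.mem_support_iff.1 hm₀ h
    · exact deletionCount_ne_zero_iff.2 (List.Perm.refl _) (Nat.cast_eq_zero.1 h)
  · intro m hm hmm
    rw [orderedMonomial_eq_wordProd, coeffFun_wordProd hc (fun p => mem_pairs_of_mem_orderedWord)
      (fun p => mem_pairs_of_mem_orderedWord) (hmax m hm)]
    have : deletionCount (orderedWord m₀) (orderedWord m) = 0 := by
      by_contra h
      exact hmm (eq_of_perm_orderedWord (deletionCount_ne_zero_iff.1 h)).symm
    rw [this, Nat.cast_zero, mul_zero]

end Classical

/-! ### Linear independence over a deformation ring -/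

section Deformation

/-- If a Noetherian domain `R` specializes to characteristic zero in such a way that `t` becomes `1`
and the kernel of the specialization is principal, then the ordered monomials are linearly
independent over `R`: by the case `q = 1` the coefficients of a linear relation lie in that kernel,
the relation can be divided by its generator, and so the coefficients lie in all its powers. -/
theorem linearIndependent_orderedMonomial_univGen {R S : Type*} [CommRing R] [IsDomain R]
    [IsNoetherianRing R] [CommRing S] [IsDomain S] [CharZero S] (κ : R →+* S) {t t' c ϖ : R}
    (h : t * t' = 1) (hc : c = t ^ 2 + t' ^ 2) (ht : κ t = 1) (hϖ₀ : ϖ ≠ 0) (hϖ : κ ϖ = 0)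
    (hker : ∀ r, κ r = 0 → ϖ ∣ r) (n : ℕ) :
    LinearIndependent R (orderedMonomial (root t t' (univGen n c)) n) := by
  let _ := κ.toAlgebra
  have ht' : κ t' = 1 := by simpa [ht] using congrArg κ h
  have hc' : κ c = 1 ^ 2 + 1 ^ 2 := by simp [hc, ht, ht']
  let M : (Pair n → ℕ) → Univ n c := orderedMonomial (root t t' (univGen n c)) n
  let P : ((Pair n → ℕ) →₀ R) → Prop := fun a => ∀ ps : List (ℕ × ℕ), (∀ p ∈ ps, p ∈ pairs n) →
    Finsupp.linearCombination R (fun m => coeffFun n h hc ps (M m)) a = 0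
  have hM : ∀ m, univMap n (c₁ := κ c) rfl (M m) =
      orderedMonomial (classicalRoot n (κ c)) n m := fun m => by
    rw [map_orderedMonomial (univMap n (c₁ := κ c) rfl) (g' := univGen n (κ c))
      (fun k hk hkn => univMap_univGen _ hk hkn)]
    congr 1
    funext k l
    rw [classicalRoot, ← root_algebraMap (S := S) t t']
    congr 1
  have hker' : ∀ a, P a → ∀ m, κ (a m) = 0 := by
    intro a ha
    have := eq_zero_of_coeffFun_eq_zero (n := n) (c := κ c) hc' (a.mapRange κ (map_zero κ)) ?_
    · intro m
      simpa using DFunLike.congr_fun this m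
    · intro ps hps
      rw [Finsupp.sum_mapRange_index (by simp)]
      have e := congrArg κ (ha ps hps)
      rw [Finsupp.linearCombination_apply, Finsupp.sum, map_sum, map_zero] at e
      rw [Finsupp.sum, ← e]
      refine Finset.sum_congr rfl fun m _ => ?_
      rw [smul_eq_mul, map_mul, ← hM, coeffFun_univMap h hc (one_mul 1) hc' ht ht' rfl]
      rfl
  have hdiv : ∀ a, P a → ∃ b, P b ∧ a = ϖ • b := by
    intro a ha
    choose b hb using fun m => hker _ (hker' a ha m)
    let b' : (Pair n → ℕ) →₀ R := Finsupp.onFinset a.support b fun m hm =>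
      Finsupp.mem_support_iff.2 (by rw [hb m]; exact mul_ne_zero hϖ₀ hm)
    have hab : a = ϖ • b' := Finsupp.ext fun m => by simp [b', hb m]
    refine ⟨b', fun ps hps => ?_, hab⟩
    have := ha ps hps
    rw [hab, map_smul, smul_eq_mul] at this
    exact (mul_eq_zero.1 this).resolve_left hϖ₀
  have hpow : ∀ k : ℕ, ∀ a, P a → ∀ m, a m ∈ Ideal.span {ϖ} ^ k := by
    intro k
    induction k with
    | zero => intro a _ m; simp
    | succ k ih =>
      intro a ha m
      obtain ⟨b, hb, rfl⟩ := hdiv a ha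
      rw [Finsupp.smul_apply, smul_eq_mul, pow_succ']
      exact Ideal.mul_mem_mul (Ideal.mem_span_singleton_self ϖ) (ih b hb m)
  rw [linearIndependent_iff]
  intro a ha
  have hPa : P a := fun ps _ => by
    have e := congrArg (coeffFun n h hc ps) ha
    rw [map_zero, Finsupp.linearCombination_apply, Finsupp.sum, map_sum] at e
    rw [Finsupp.linearCombination_apply, Finsupp.sum, ← e]
    refine Finset.sum_congr rfl fun m _ => ?_
    rw [map_smul]
  have htop : Ideal.span {ϖ} ≠ ⊤ := by
    rw [Ne, Ideal.span_singleton_eq_top]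
    intro hu
    exact (hu.map κ).ne_zero hϖ
  ext m
  have : a m ∈ ⨅ k : ℕ, Ideal.span {ϖ} ^ k := (Ideal.mem_iInf).2 fun k => hpow k a hPa m
  rwa [Ideal.iInf_pow_eq_bot_of_isDomain _ htop, Ideal.mem_bot] at this

open Polynomial in
/-- The localization of `ℂ[X]` at the polynomials which vanish neither at `x` nor at `1`: a
Noetherian domain with specializations at `x` and at `1`. -/
theorem exists_deformation_ring (x : ℂ) :
    ∃ (R : Type) (_ : CommRing R) (_ : IsDomain R) (_ : IsNoetherianRing R) (κ₀ κ₁ : R →+* ℂ)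
      (t ϖ : R), κ₀ t = x ∧ κ₁ t = 1 ∧ ϖ ≠ 0 ∧ κ₁ ϖ = 0 ∧ (∀ r, κ₁ r = 0 → ϖ ∣ r) ∧
        ∀ r, κ₀ r ≠ 0 → κ₁ r ≠ 0 → IsUnit r := by
  let S : Submonoid ℂ[X] := (nonZeroDivisors ℂ).comap (evalRingHom x) ⊓
    (nonZeroDivisors ℂ).comap (evalRingHom 1)
  have hS : ∀ p, p ∈ S ↔ p.eval x ≠ 0 ∧ p.eval 1 ≠ 0 := fun p => by
    simp [S, Submonoid.mem_inf]
  have hle : S ≤ nonZeroDivisors ℂ[X] := fun p hp => by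
    refine mem_nonZeroDivisors_of_ne_zero ?_
    rintro rfl
    simp [hS] at hp
  have hx : ∀ p : S, IsUnit (evalRingHom x (p : ℂ[X])) := fun p =>
    isUnit_iff_ne_zero.2 ((hS p).1 p.2).1
  have h1 : ∀ p : S, IsUnit (evalRingHom 1 (p : ℂ[X])) := fun p =>
    isUnit_iff_ne_zero.2 ((hS p).1 p.2).2
  let κ₀ : Localization S →+* ℂ := IsLocalization.lift (M := S) hx
  let κ₁ : Localization S →+* ℂ := IsLocalization.lift (M := S) h1
  have e₀ : ∀ p : ℂ[X], κ₀ (algebraMap _ _ p) = p.eval x := fun p => IsLocalization.lift_eq hx p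
  have e₁ : ∀ p : ℂ[X], κ₁ (algebraMap _ _ p) = p.eval 1 := fun p => IsLocalization.lift_eq h1 p
  -- Every element is associated to a polynomial.
  have hnum : ∀ r : Localization S, ∃ (p : ℂ[X]) (u : Localization S), IsUnit u ∧
      r * u = algebraMap _ _ p := fun r => by
    obtain ⟨⟨p, s⟩, hps⟩ := IsLocalization.surj S r
    exact ⟨p, _, IsLocalization.map_units _ s, hps⟩
  refine ⟨Localization S, inferInstance, IsLocalization.isDomain_localization hle,
    IsLocalization.isNoetherianRing S _ inferInstance, κ₀, κ₁, algebraMap ℂ[X] _ X,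
    algebraMap ℂ[X] _ (X - C 1), ?_, ?_, ?_, ?_, ?_, ?_⟩
  · simp [e₀]
  · simp [e₁]
  · intro h0
    rw [IsLocalization.to_map_eq_zero_iff _ hle] at h0
    exact X_sub_C_ne_zero 1 h0
  · simp [e₁]
  · intro r hr
    obtain ⟨p, u, hu, hp⟩ := hnum r
    have hp1 : p.eval 1 = 0 := by rw [← e₁, ← hp, map_mul, hr, zero_mul]
    rw [← hu.dvd_mul_right, hp]
    exact map_dvd _ (dvd_iff_isRoot.2 hp1)
  · intro r hr0 hr1
    obtain ⟨p, u, hu, hp⟩ := hnum r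
    have hpS : p ∈ S := by
      rw [hS, ← e₀, ← e₁, ← hp, map_mul, map_mul]
      exact ⟨mul_ne_zero hr0 (hu.map κ₀).ne_zero, mul_ne_zero hr1 (hu.map κ₁).ne_zero⟩
    have : IsUnit (r * u) := hp ▸ IsLocalization.map_units (Localization S) ⟨p, hpS⟩
    exact isUnit_of_mul_isUnit_left this

end Deformation

/-! ### The algebra `U'_q(so_n)` -/

section UqSo

variable {n : ℕ} {q : ℂ}

theorem gen_of_mem {k : ℕ} (h : 2 ≤ k ∧ k ≤ n) :
    gen n q k = RingQuot.mkAlgHom ℂ (Rel n q) (freeGen ⟨k, h⟩) := dif_pos h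

theorem isSoFamily_gen (n : ℕ) (q : ℂ) : IsSoFamily n (q + q⁻¹) (gen n q) where
  left i hi hin := by
    rw [gen_of_mem ⟨hi, by omega⟩, gen_of_mem ⟨by omega, hin⟩, CubicRel]
    simpa using RingQuot.mkAlgHom_rel ℂ (Rel.serre_left (q := q) (n := n) ⟨i, _⟩ ⟨i + 1, _⟩ rfl)
  right i hi hin := by
    rw [gen_of_mem ⟨hi, by omega⟩, gen_of_mem ⟨by omega, hin⟩, CubicRel, sub_add_eq_add_sub,
      add_comm, ← sub_add_eq_add_sub]
    simpa using RingQuot.mkAlgHom_rel ℂ (Rel.serre_right (q := q) (n := n) ⟨i, _⟩ ⟨i + 1, _⟩ rfl)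
  comm i j hi hij hj := by
    rw [gen_of_mem ⟨hi, by omega⟩, gen_of_mem ⟨by omega, hj⟩, Commute, SemiconjBy, ← sub_eq_zero]
    simpa using RingQuot.mkAlgHom_rel ℂ (Rel.comm (q := q) (n := n) ⟨i, _⟩ ⟨j, _⟩ (Or.inl hij))

theorem adjoin_gen (n : ℕ) (q : ℂ) : Algebra.adjoin ℂ (gen n q '' Set.Icc 2 n) = ⊤ := by
  have h : (RingQuot.mkAlgHom ℂ (Rel n q)).range = ⊤ :=
    (AlgHom.range_eq_top _).2 (RingQuot.mkAlgHom_surjective ℂ (Rel n q))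
  rw [eq_top_iff, ← h, ← Algebra.map_top, ← FreeAlgebra.adjoin_range_ι, AlgHom.map_adjoin]
  refine Algebra.adjoin_mono ?_
  rintro _ ⟨_, ⟨k, rfl⟩, rfl⟩
  exact ⟨k.1, k.2, gen_of_mem k.2⟩

theorem rootElem_eq_root (t : ℂ) (k l : ℕ) :
    rootElem n q t k l = root t t⁻¹ (gen n q) k l := by
  by_cases h : l + 1 < k
  · rw [rootElem, if_pos h, root_of_lt h, rootElem_eq_root t k (l + 1)]
    rfl
  · rw [rootElem, if_neg h, root_of_not_lt h]
termination_by k - l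

theorem monomial_eq_orderedMonomial (t : ℂ) (m : Pair n → ℕ) :
    monomial n q t m = orderedMonomial (root t t⁻¹ (gen n q)) n m := by
  rw [monomial, orderedMonomial, pairs, List.map_flatMap, List.flatMap_def, List.prod_flatten,
    List.map_map]
  simp only [Function.comp_def, List.map_map, rootElem_eq_root]

/-- The homomorphism from `U'_q(so_n)` given by a family satisfying the relations. -/
noncomputable def uqSoLift {A : Type*} [Ring A] [Algebra ℂ A] {g : ℕ → A}
    (hg : IsSoFamily n (q + q⁻¹) g) : UqSo n q →ₐ[ℂ] A :=
  RingQuot.liftAlgHom ℂ ⟨FreeAlgebra.lift ℂ fun k : Gen n => g k, by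
    rintro _ _ (⟨i, j, h⟩ | ⟨i, j, h⟩ | ⟨i, j, h⟩)
    · have := hg.left i i.2.1 (h ▸ j.2.2)
      rw [← h, CubicRel] at this
      simpa using this
    · have := hg.right i i.2.1 (h ▸ j.2.2)
      rw [← h, CubicRel, sub_add_eq_add_sub, add_comm, ← sub_add_eq_add_sub] at this
      simpa using this
    · rcases h with h | h
      · simpa [sub_eq_zero] using (hg.comm i j i.2.1 h j.2.2).eq
      · simpa [sub_eq_zero] using (hg.comm j i j.2.1 h i.2.2).eq.symm⟩

theorem uqSoLift_gen {A : Type*} [Ring A] [Algebra ℂ A] {g : ℕ → A}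
    (hg : IsSoFamily n (q + q⁻¹) g) {k : ℕ} (hk : 2 ≤ k) (hkn : k ≤ n) :
    uqSoLift hg (gen n q k) = g k := by
  rw [gen_of_mem ⟨hk, hkn⟩, uqSoLift, RingQuot.liftAlgHom_mkAlgHom_apply,
    FreeAlgebra.lift_ι_apply]

/-- Linear independence passes from a deformation ring over which the ordered monomials form a basis
to its complex specializations. -/
theorem linearIndependent_monomial {R : Type*} [CommRing R] (κ : R →+* ℂ) {t t' c : R}
    (h : t * t' = 1) (hcq : κ c = q + q⁻¹)
    (b : Module.Basis (Pair n → ℕ) R (Univ n c))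
    (hb : ∀ m, b m = orderedMonomial (root t t' (univGen n c)) n m) :
    LinearIndependent ℂ (monomial n q (κ t)) := by
  let _ := κ.toAlgebra
  let ι : Univ n c →ₐ[R] TensorProduct R ℂ (Univ n c) := Algebra.TensorProduct.includeRight
  have hg : IsSoFamily n (q + q⁻¹) fun k => ι (univGen n c k) := by
    rw [← hcq]
    exact isSoFamily_algebraMap_iff.2 ((isSoFamily_univGen n c).map ι)
  have ht' : (κ t)⁻¹ = κ t' := inv_eq_of_mul_eq_one_right (by rw [← map_mul, h, map_one])
  refine LinearIndependent.of_comp (uqSoLift hg).toLinearMap ?_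
  suffices e : (uqSoLift hg).toLinearMap ∘ monomial n q (κ t) = b.baseChange ℂ from
    e ▸ (b.baseChange ℂ).linearIndependent
  funext m
  rw [Function.comp_apply, monomial_eq_orderedMonomial, AlgHom.toLinearMap_apply,
    map_orderedMonomial (uqSoLift hg) fun k hk hkn => uqSoLift_gen hg hk hkn,
    Module.Basis.baseChange_apply, hb]
  have e := map_orderedMonomial (t := t) (t' := t') ι (g := univGen n c) (fun k _ _ => rfl) m
  refine Eq.trans ?_ e.symm
  congr 1
  funext k l
  rw [ht']
  exact root_algebraMap t t' _ k l

/-- Both root elements `I⁺` (for `t = q^{1/2}`) and `I⁻` (for `t = q^{-1/2}`) are covered, because the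
hypothesis on `t` is symmetric under `t ↦ t⁻¹`. -/
theorem exists_basis_monomial {t : ℂ} (ht : t ≠ 0) (hq : q + q⁻¹ = t ^ 2 + t⁻¹ ^ 2)
    (hn : 4 ≤ n → q + q⁻¹ ≠ 0) :
    ∃ b : Module.Basis (Pair n → ℕ) ℂ (UqSo n q), ∀ m, b m = monomial n q t m := by
  obtain ⟨R, _, _, _, κ₀, κ₁, T, ϖ, h0, h1, hϖ₀, hϖ, hker, hunit⟩ := exists_deformation_ring t
  obtain ⟨T', hT⟩ := (hunit T (by rwa [h0]) (by rw [h1]; exact one_ne_zero)).exists_right_inv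
  have hT0 : κ₀ T' = t⁻¹ := by
    rw [← h0]
    exact (inv_eq_of_mul_eq_one_right (by rw [← map_mul, hT, map_one])).symm
  have hT1 : κ₁ T' = 1 := by simpa [h1] using congrArg κ₁ hT
  set c : R := T ^ 2 + T' ^ 2 with hc
  have hc0 : κ₀ c = q + q⁻¹ := by rw [hc, hq, map_add, map_pow, map_pow, h0, hT0]
  have hu : 4 ≤ n → IsUnit c := fun h => by
    refine hunit c (by rw [hc0]; exact hn h) ?_
    rw [hc, map_add, map_pow, map_pow, h1, hT1]
    norm_num
  have hli := linearIndependent_orderedMonomial_univGen κ₁ hT hc h1 hϖ₀ hϖ hker n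
  have hsp := span_orderedMonomial hT hc hu (isSoFamily_univGen n c) (adjoin_univGen n c)
  have hli' : LinearIndependent ℂ (monomial n q t) := by
    rw [← h0]
    exact linearIndependent_monomial κ₀ hT hc0 (Module.Basis.mk hli hsp.ge)
      fun m => Module.Basis.mk_apply hli hsp.ge m
  have hsp' : Submodule.span ℂ (Set.range (monomial n q t)) = ⊤ := by
    have e : monomial n q t = orderedMonomial (root t t⁻¹ (gen n q)) n :=
      funext fun m => monomial_eq_orderedMonomial t m
    rw [e]
    exact span_orderedMonomial (mul_inv_cancel₀ ht) hq (fun h => (hn h).isUnit)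
      (isSoFamily_gen n q) (adjoin_gen n q)
  exact ⟨Module.Basis.mk hli' hsp'.ge, fun m => Module.Basis.mk_apply hli' hsp'.ge m⟩

end UqSo

end QSo

theorem theorem2 (n : ℕ) (q s : ℂ) (hq : q ≠ 0) (hs : s ^ 2 = q)
    (hn : 4 ≤ n → q ^ 2 ≠ -1) :
    (∃ b : Module.Basis (QSo.Pair n → ℕ) ℂ (QSo.UqSo n q),
      ∀ m, b m = QSo.monomial n q s m) ∧
    (∃ b : Module.Basis (QSo.Pair n → ℕ) ℂ (QSo.UqSo n q),
      ∀ m, b m = QSo.monomial n q s⁻¹ m) := by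
  have hs0 : s ≠ 0 := by
    rintro rfl
    exact hq (by rw [← hs]; simp)
  have hc : q + q⁻¹ = s ^ 2 + s⁻¹ ^ 2 := by rw [inv_pow, hs]
  have hu : 4 ≤ n → q + q⁻¹ ≠ 0 := fun h h0 => by
    refine hn h ?_
    have : q * (q + q⁻¹) = 0 := by rw [h0, mul_zero]
    rw [mul_add, mul_inv_cancel₀ hq, ← pow_two] at this
    exact eq_neg_of_add_eq_zero_left this
  exact ⟨QSo.exists_basis_monomial hs0 hc hu, QSo.exists_basis_monomial (inv_ne_zero hs0)
    (by rw [hc, inv_inv, add_comm]) hu⟩
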